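/- Fix $d\ge 1$. For $n\ge 2$ let $\mathbb T^d_n=\mathbb Z^d/n\mathbb Z^d$, with $x\sim y$ when $y=x\pm e_i$ for some $i$, and let $\Omega_n=\{0,1\}^{\mathbb T^d_n}$. For $a,b>0$ and $\lambda>-a$ consider the reaction-diffusion model, that is, the Markov chain on $\Omega_n$ with generator $$L_n h(\eta)=n^2\sum_{\{x,y\}:\,x\sim y}\big(h(\eta^{x,y})-h(\eta)\big)+\sum_{x\in\mathbb T^d_n}c_x(\eta)\big(h(\eta^x)-h(\eta)\big),$$ $$c_x(\eta)=\Big(a+\frac{\lambda}{2d}\sum_{y\sim x}\eta_y\Big)(1-\eta_x)+b\,\eta_x ,$$ where $\eta^{x,y}$ is $\eta$ with the values at $x,y$ exchanged, $\eta^x$ is $\eta$ with the value at $x$ flipped, and the first sum is over unordered pairs. Let $\mu^n_{ss}$ be its unique invariant probability measure, let $\rho_*$ be the unique zero in $[0,1]$ of $F(\rho)=(a+\lambda\rho)(1-\rho)-b\rho$ (one has $0<\rho_*<1$), and let $\nu^n_\rho$ be the Bernoulli product measure on $\Omega_n$ of density $\rho$. Put $g_1(n)=n$, $g_2(n)=\log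 n$ and $g_d(n)=1$ for $d\ge 3$. A function $\psi:\{0,1\}^{\mathbb Z^d}\to\mathbb R$ has support in $B_R=\{z\in\mathbb Z^d:\ |z_i|\le R,\ i=1,\dots,d\}$ if it depends only on the coordinates in $B_R$; it is regarded as a function on $\Omega_n$ through the canonical projection $\mathbb Z^d\to\mathbb T^d_n$. Write $(\tau_x\eta)_z=\eta_{z+x}$, $\tau_x\psi(\eta)=\psi(\tau_x\eta)$, $\langle\psi\rangle_{\rho}=\int\psi\,d\nu^n_{\rho}$, and for $f\in\mathcal C(\mathbb T^d;\mathbb R)$, where $\mathbb T^d=\mathbb R^d/\mathbb Z^d$, $$\Psi^n(f;\eta)=\frac1{n^d}\sum_{x\in\mathbb T^d_n}\big(\tau_x\psi(\eta)-\langle\psi\rangle_{\rho_*}\big)f\big(\tfrac xn\big),\qquad \|f\|^2_{\ell^2_n}=\frac1{n^d}\sum_{x\in\mathbb T^d_n}f\big(\tfrac xn\big)^2 .$$ **Theorem 3.2.** For all $a,b>0$ there is $\lambda_c=\lambda_c(a,b,d)\in(0,a)$ such that, with these $\lambda_c$, the following holds. For every $R\in\mathbb N_0$ and every $\psi$ with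 support in $B_R$ there is a constant $C=C(\psi;\rho_*)$, depending only on $\psi$ (hence on $d$) and on $\rho_*$, and continuously on $\rho_*\in(0,1)$, such that for all $a,b>0$, all $\lambda\in[-\lambda_c,\lambda_c]$, all $n\ge 2$ and all $f\in\mathcal C(\mathbb T^d;\mathbb R)$, $$\int\Psi^n(f)^2\,d\mu^n_{ss}\le\frac{C\,\|f\|^2_{\ell^2_n}\,g_d(n)}{n^2}.$$ -/

import Mathlib

namespace ReactionDiffusion

/-- The discrete torus `ℤ^d / n ℤ^d`. -/
abbrev Site (d n : ℕ) : Type := Fin d → ZMod n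

/-- Particle configurations `{0,1}^(torus)`; `true` means that the site is occupied. -/
abbrev Config (d n : ℕ) : Type := Site d n → Bool

/-- Nearest neighbours on the discrete torus (for `2 ≤ n`: torus `ℓ¹`-distance equal to one). -/
def Nbr {d n : ℕ} (x y : Site d n) : Prop :=
  ∃ i : Fin d, y = x + Pi.single i 1 ∨ y = x - Pi.single i 1

/-- The occupation number `η_x`, as a real number. -/
def occ {d n : ℕ} (η : Config d n) (x : Site d n) : ℝ := if η x then 1 else 0

/-- The configuration `η^{x,y}`: the values at `x` and `y` are exchanged. -/
def exchange {d n : ℕ} (η : Config d n) (x y : Site d n) : Config d n :=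
  fun z => η (Equiv.swap x y z)

/-- The configuration `η^x`: the value at `x` is flipped. -/
def flip {d n : ℕ} (η : Config d n) (x : Site d n) : Config d n :=
  Function.update η x (!(η x))

open Classical in
/-- The reaction rate
`c_x(η) = (a + (lam / 2d) ∑_{y ∼ x} η_y) (1 - η_x) + b η_x`. -/
noncomputable def rate {d n : ℕ} [NeZero n] (a b lam : ℝ) (x : Site d n) (η : Config d n) : ℝ :=
  (a + lam / (2 * d) * ∑ y : Site d n with Nbr x y, occ η y) * (1 - occ η x) + b * occ η x

open Classical in
/-- The exclusion part of the generator. The sum runs over unordered pairs of neighbours, that is,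
it is half of the sum over ordered pairs. -/
noncomputable def genEx {d n : ℕ} [NeZero n] (h : Config d n → ℝ) (η : Config d n) : ℝ :=
  (n : ℝ) ^ 2 *
    ((1 / 2) * ∑ x : Site d n, ∑ y : Site d n with Nbr x y, (h (exchange η x y) - h η))

/-- The reaction part of the generator. -/
noncomputable def genReact {d n : ℕ} [NeZero n] (a b lam : ℝ) (h : Config d n → ℝ)
    (η : Config d n) : ℝ :=
  ∑ x : Site d n, rate a b lam x η * (h (flip η x) - h η)

/-- The generator `L_n` of the reaction-diffusion model. -/
noncomputable def gen {d n : ℕ} [NeZero n] (a b lam : ℝ) (h : Config d n → ℝ)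
    (η : Config d n) : ℝ :=
  genEx h η + genReact a b lam h η

/-- Expectation of `h` under the measure on the finite set of configurations that gives the mass
`μ η` to `η`. -/
noncomputable def expect {d n : ℕ} [NeZero n] (μ h : Config d n → ℝ) : ℝ :=
  ∑ η : Config d n, μ η * h η

/-- `μ` is an invariant probability measure of the Markov chain with generator `L_n`. For
`0 < a`, `0 < b`, `-a < lam` the chain is irreducible on a finite set, and there is exactly one. -/
def IsStationary {d n : ℕ} [NeZero n] (a b lam : ℝ) (μ : Config d n → ℝ) : Prop :=
  μ ∈ stdSimplex ℝ (Config d n) ∧ ∀ h : Config d n → ℝ, expect μ (gen a b lam h) = 0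

/-- The Bernoulli product measure of density `ρ`. -/
noncomputable def bernoulli {d n : ℕ} [NeZero n] (ρ : ℝ) (η : Config d n) : ℝ :=
  ∏ x : Site d n, (occ η x * ρ + (1 - occ η x) * (1 - ρ))

/-- The effective reaction function `F(ρ) = (a + lam ρ) (1 - ρ) - b ρ`. -/
def reaction (a b lam ρ : ℝ) : ℝ := (a + lam * ρ) * (1 - ρ) - b * ρ

/-- The function `g_d(n)`: it is `n` for `d = 1`, `log n` for `d = 2`, and `1` for `3 ≤ d`. -/
noncomputable def g (d n : ℕ) : ℝ :=
  if d = 1 then (n : ℝ) else if d = 2 then Real.log n else 1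

/-- A function of the configurations on `ℤ^d` has support in the cube
`B_R = {z ∈ ℤ^d : |z_i| ≤ R for all i}` if it only depends on the coordinates in that cube. -/
def HasSupportIn {d : ℕ} (R : ℕ) (ψ : ((Fin d → ℤ) → Bool) → ℝ) : Prop :=
  ∀ η ζ : (Fin d → ℤ) → Bool, (∀ z : Fin d → ℤ, (∀ i, |z i| ≤ (R : ℤ)) → η z = ζ z) → ψ η = ψ ζ

/-- A function of the configurations on `ℤ^d`, as a function of the configurations on the torus:
a configuration on the torus is read through the canonical projection of `ℤ^d` onto the torus. -/
def onTorus {d : ℕ} (n : ℕ) (ψ : ((Fin d → ℤ) → Bool) → ℝ) (η : Config d n) : ℝ :=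
  ψ fun z => η fun i => (z i : ZMod n)

/-- The translation `τ_x η`. -/
def shift {d n : ℕ} (x : Site d n) (η : Config d n) : Config d n := fun z => η (z + x)

/-- The point `x / n` of the continuous torus `𝕋^d`. -/
noncomputable def toTorus {d n : ℕ} [NeZero n] (x : Site d n) : UnitAddTorus (Fin d) :=
  fun i => ZMod.toAddCircle (x i)

/-- The field
`Ψ^n(f; η) = n^{-d} ∑_x (ψ(τ_x η) - ⟨ψ⟩_ρ) f(x / n)`. -/
noncomputable def field {d n : ℕ} [NeZero n] (ψ : ((Fin d → ℤ) → Bool) → ℝ) (ρ : ℝ)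
    (f : C(UnitAddTorus (Fin d), ℝ)) (η : Config d n) : ℝ :=
  (1 / (n : ℝ) ^ d) * ∑ x : Site d n,
    (onTorus n ψ (shift x η) - expect (bernoulli ρ) (onTorus n ψ)) * f (toTorus x)

/-- The square of the norm of `f` in `ℓ²_n`: the average of `f(x / n)²` over the torus. -/
noncomputable def normSq {d : ℕ} (n : ℕ) [NeZero n] (f : C(UnitAddTorus (Fin d), ℝ)) : ℝ :=
  (1 / (n : ℝ) ^ d) * ∑ x : Site d n, f (toTorus x) ^ 2

end ReactionDiffusion

namespace ReactionDiffusion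

open Finset

/-! The proof controls all correlations of the centred variables `occ η x - ρ` at once. Testing
stationarity against the product over a set `A` gives a linear hierarchy (`moment_equation`).
Exclusion moves the points of `A` at speed `n ^ 2`. The reaction damps at rate `a + b + lam * ρ` per
point and couples `A` to other sets with strength `|lam|`. Since `ρ` is a zero of the reaction
function, single sites carry no source. The only source is the constant part `ρ * (1 - ρ)` of the
square `(occ η y - ρ) ^ 2`, and it reaches the empty correlation, which equals 1, only when `A` is a
pair of neighbours (`abs_interaction_le`).

Correlations are thus created at rate of order `|lam|` on neighbouring pairs and then spread by a
fast walk. A multiple of the Green function of the difference walk, killed at rate `κ`, is a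
supersolution for this source (`pairGreen_supersolution`). A maximum principle over all nonempty
sets, closed by `|lam| ≤ κ ≤ a / 16`, bounds every correlation by `32 * κ * G(0)` with `G = green κ`
(`abs_corr_le`). In Fourier variables `κ * G(0)` is at most a constant times `n ^ (-d) * (1 + ∑ 1 /
|k| ^ 2)`, the sum running over nonzero frequencies, which has order `g d n / n ^ 2`
(`mul_green_zero_le_g`).

A local function minus its Bernoulli mean is a combination of centred products over nonempty sets
(`exists_expansion`). In the second moment of the field, translates with disjoint supports therefore
contribute correlations of nonempty sets. The boundedly many overlapping displacements cost `n ^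
(-d)`, which is no larger in order. -/

open Classical in
/-- The nearest neighbours of the origin of the discrete torus. -/
noncomputable def nbrs (d n : ℕ) [NeZero n] : Finset (Site d n) :=
  Finset.univ.filter fun e => Nbr 0 e

/-! ### Neighbours of the origin in the discrete torus -/

section Neighbours

variable {d n : ℕ} [NeZero n]

lemma mem_nbrs {e : Site d n} :
    e ∈ nbrs d n ↔ ∃ i : Fin d, e = Pi.single i 1 ∨ e = -Pi.single i 1 := by
  simp [nbrs, Nbr]

lemma neg_mem_nbrs {e : Site d n} (he : e ∈ nbrs d n) : -e ∈ nbrs d n := by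
  rw [mem_nbrs] at he ⊢
  obtain ⟨i, rfl | rfl⟩ := he
  · exact ⟨i, Or.inr rfl⟩
  · exact ⟨i, Or.inl (neg_neg _)⟩

lemma single_mem_nbrs (i : Fin d) : (Pi.single i 1 : Site d n) ∈ nbrs d n :=
  mem_nbrs.2 ⟨i, Or.inl rfl⟩

lemma zero_notMem_nbrs (hn : 2 ≤ n) : (0 : Site d n) ∉ nbrs d n := by
  intro h
  rw [mem_nbrs] at h
  have : Fact (1 < n) := ⟨hn⟩
  obtain ⟨i, h | h⟩ := h
  · simpa using congrFun h i
  · simpa using congrFun h i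

lemma nbr_iff {x y : Site d n} : Nbr x y ↔ y - x ∈ nbrs d n := by
  rw [mem_nbrs]
  refine exists_congr fun i => or_congr ?_ ?_
  · rw [sub_eq_iff_eq_add']
  · rw [sub_eq_iff_eq_add', sub_eq_add_neg]

lemma Nbr.symm {x y : Site d n} (h : Nbr x y) : Nbr y x := by
  rw [nbr_iff] at h ⊢
  simpa using neg_mem_nbrs h

lemma sum_neg_nbrs (F : Site d n → ℝ) : ∑ e ∈ nbrs d n, F (-e) = ∑ e ∈ nbrs d n, F e :=
  Finset.sum_bij' (fun e _ => -e) (fun e _ => -e) (fun _ h => neg_mem_nbrs h)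
    (fun _ h => neg_mem_nbrs h) (by simp) (by simp) (by simp)

open Classical in
lemma sum_nbr (x : Site d n) (F : Site d n → ℝ) :
    ∑ y : Site d n with Nbr x y, F y = ∑ e ∈ nbrs d n, F (x + e) := by
  refine Finset.sum_bij' (fun y _ => y - x) (fun e _ => x + e) ?_ ?_ ?_ ?_ ?_
  · intro y hy
    exact nbr_iff.1 (by simpa using hy)
  · intro e he
    simpa [nbr_iff] using he
  · intro y _; simp
  · intro y _; simp
  · intro y _; simp

lemma nbrs_eq_image :
    nbrs d n = (Finset.univ : Finset (Fin d × Bool)).image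
      fun p => if p.2 then (Pi.single p.1 1 : Site d n) else -Pi.single p.1 1 := by
  ext e
  rw [mem_nbrs]
  simp only [mem_image, mem_univ, true_and, Prod.exists, Bool.exists_bool, Bool.false_eq_true,
    if_false, if_true]
  exact exists_congr fun i => by rw [or_comm, eq_comm, @eq_comm _ e]

lemma card_nbrs_le : (nbrs d n).card ≤ 2 * d := by
  rw [nbrs_eq_image]
  refine Finset.card_image_le.trans ?_
  simp [mul_comm]

/-- For `n = 2` the steps `e_i` and `-e_i` coincide and the count is only `d`; this is why that case
is treated separately in the main theorem. -/
lemma card_nbrs (hn : 3 ≤ n) : (nbrs d n).card = 2 * d := by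
  have h1 : (1 : ZMod n) ≠ 0 := by
    have : Fact (1 < n) := ⟨by omega⟩
    exact one_ne_zero
  have h2 : (1 : ZMod n) ≠ -1 := by
    have : Fact (2 < n) := ⟨by omega⟩
    exact (ZMod.neg_one_ne_one).symm
  rw [nbrs_eq_image, Finset.card_image_of_injective]
  · simp [mul_comm]
  · rintro ⟨i, s⟩ ⟨j, t⟩ h
    have hi := congrFun h i
    by_cases hij : i = j
    · subst hij
      cases s <;> cases t
      · rfl
      · exact absurd (by simpa using hi.symm) h2
      · exact absurd (by simpa using hi) h2
      · rfl
    · refine absurd ?_ h1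
      cases s <;> cases t <;> simpa [Pi.single_eq_of_ne hij] using hi

end Neighbours

/-! ### Characters of the torus and the symbol of the walk -/

section Fourier

variable {d n : ℕ} [NeZero n]

/-- The real part of the character of the torus with frequency `k`. -/
noncomputable def wave (k z : Site d n) : ℝ := (ZMod.stdAddChar (N := n) (k ⬝ᵥ z)).re

lemma wave_zero (k : Site d n) : wave k 0 = 1 := by simp [wave]

lemma zero_wave (z : Site d n) : wave 0 z = 1 := by simp [wave]

lemma wave_neg (k z : Site d n) : wave k (-z) = wave k z := by
  rw [wave, dotProduct_neg, AddChar.map_neg_eq_conj, Complex.conj_re, wave]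

lemma abs_wave_le (k z : Site d n) : |wave k z| ≤ 1 :=
  (Complex.abs_re_le_norm _).trans (AddChar.norm_apply _ _).le

lemma wave_le_one (k z : Site d n) : wave k z ≤ 1 := (abs_le.1 (abs_wave_le k z)).2

lemma wave_add_add_wave_sub (k z e : Site d n) :
    wave k (z + e) + wave k (z - e) = 2 * wave k z * wave k e := by
  simp only [wave, sub_eq_add_neg, dotProduct_add, dotProduct_neg, AddChar.map_add_eq_mul,
    AddChar.map_neg_eq_conj, Complex.mul_re, Complex.conj_re, Complex.conj_im]
  ring

lemma sum_nbrs_wave (k z : Site d n) :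
    ∑ e ∈ nbrs d n, wave k (z + e) = wave k z * ∑ e ∈ nbrs d n, wave k e := by
  have h : ∑ e ∈ nbrs d n, wave k (z + e) = ∑ e ∈ nbrs d n, wave k (z - e) := by
    simpa [sub_eq_add_neg] using (sum_neg_nbrs fun e => wave k (z + e)).symm
  have h2 : ∑ e ∈ nbrs d n, (wave k (z + e) + wave k (z - e))
      = 2 * (wave k z * ∑ e ∈ nbrs d n, wave k e) := by
    rw [Finset.mul_sum, Finset.mul_sum]
    exact Finset.sum_congr rfl fun e _ => by rw [wave_add_add_wave_sub]; ring
  rw [Finset.sum_add_distrib, ← h] at h2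
  linarith

lemma sum_wave (z : Site d n) : ∑ k : Site d n, wave k z = if z = 0 then (n : ℝ) ^ d else 0 := by
  split_ifs with h
  · simp [h, wave_zero, ZMod.card]
  · obtain ⟨i, hi⟩ := Function.ne_iff.1 h
    let χ : AddChar (Site d n) ℂ :=
      (ZMod.stdAddChar (N := n)).compAddMonoidHom
        ⟨⟨fun k => k ⬝ᵥ z, by simp⟩, fun a b => by simp [add_dotProduct]⟩
    have hχ : χ ≠ 0 := by
      intro h0
      have h1 : χ (Pi.single i 1) = 1 := by rw [h0]; rfl
      have h2 : χ (Pi.single i 1) = ZMod.stdAddChar (N := n) (z i) := by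
        change ZMod.stdAddChar (N := n) ((Pi.single i 1 : Site d n) ⬝ᵥ z) = _
        simp
      rw [h2] at h1
      exact hi (ZMod.injective_stdAddChar (by simpa using h1))
    have := congrArg Complex.re (AddChar.sum_eq_zero_iff_ne_zero.2 hχ)
    rw [Complex.re_sum] at this
    exact this

/-- The eigenvalue of minus the generator of the difference of two independent particles. -/
noncomputable def freq (k : Site d n) : ℝ := 2 * (n : ℝ) ^ 2 * ∑ e ∈ nbrs d n, (1 - wave k e)

lemma freq_nonneg (k : Site d n) : 0 ≤ freq k :=
  mul_nonneg (by positivity) (Finset.sum_nonneg fun e _ => sub_nonneg.2 (wave_le_one k e))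

lemma freq_zero : freq (0 : Site d n) = 0 := by simp [freq, zero_wave]

/-- The sup norm of the representative of `k` closest to the origin. -/
def supNorm (k : Site d n) : ℕ := Finset.univ.sup fun i => (k i).valMinAbs.natAbs

omit [NeZero n] in
lemma supNorm_le_iff {k : Site d n} {m : ℕ} :
    supNorm k ≤ m ↔ ∀ i, (k i).valMinAbs.natAbs ≤ m := by
  simp [supNorm]

lemma supNorm_le (k : Site d n) : supNorm k ≤ n :=
  supNorm_le_iff.2 fun _ => (ZMod.natAbs_valMinAbs_le _).trans (Nat.div_le_self _ _)

omit [NeZero n] in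
lemma one_le_supNorm {k : Site d n} (hk : k ≠ 0) : 1 ≤ supNorm k := by
  by_contra h
  have h0 : supNorm k ≤ 0 := by omega
  rw [supNorm_le_iff] at h0
  refine hk (funext fun i => ?_)
  have := h0 i
  simpa using this

/-- This is `cos θ ≤ 1 - 2 θ² / π²`, valid for `|θ| ≤ π`, at `θ = 2 π j / n` with `j` the
representative of `k i` of least absolute value. -/
lemma one_sub_wave_single (k : Site d n) (i : Fin d) :
    8 * ((k i).valMinAbs.natAbs : ℝ) ^ 2 / (n : ℝ) ^ 2 ≤ 1 - wave k (Pi.single i 1) := by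
  have hn : (0 : ℝ) < n := by exact_mod_cast NeZero.pos n
  set j : ℤ := (k i).valMinAbs with hj
  have hw : wave k (Pi.single i 1) = Real.cos (2 * Real.pi * j / n) := by
    rw [wave, dotProduct_single, mul_one, ← ZMod.coe_valMinAbs (k i), ZMod.stdAddChar_coe, ← hj]
    have : (2 * Real.pi * Complex.I * j / n : ℂ)
        = ((2 * Real.pi * j / n : ℝ) : ℂ) * Complex.I := by push_cast; ring
    rw [this, Complex.exp_ofReal_mul_I_re]
  have hjn : |(j : ℝ)| * 2 ≤ n := by
    have h1 := ZMod.natAbs_valMinAbs_le (k i)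
    have h2 : (k i).valMinAbs.natAbs * 2 ≤ n := by omega
    have h3 : ((j.natAbs : ℕ) : ℝ) * 2 ≤ n := by exact_mod_cast h2
    rwa [Nat.cast_natAbs, Int.cast_abs] at h3
  have hle : |2 * Real.pi * j / n| ≤ Real.pi := by
    rw [abs_div, abs_mul, abs_of_pos hn, div_le_iff₀ hn, abs_of_pos Real.two_pi_pos]
    nlinarith [Real.pi_pos]
  have := Real.cos_le_one_sub_mul_cos_sq hle
  have hsq : ((j.natAbs : ℕ) : ℝ) ^ 2 = (j : ℝ) ^ 2 := by
    rw [Nat.cast_natAbs, Int.cast_abs, sq_abs]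
  rw [hw, hsq]
  have h5 : 2 / Real.pi ^ 2 * (2 * Real.pi * j / n) ^ 2 = 8 * (j : ℝ) ^ 2 / (n : ℝ) ^ 2 := by
    have := Real.pi_ne_zero
    field_simp
    ring
  linarith

lemma supNorm_sq_le_freq (k : Site d n) : 16 * (supNorm k : ℝ) ^ 2 ≤ freq k := by
  have hn : (0 : ℝ) < n := by exact_mod_cast NeZero.pos n
  rcases Finset.univ.eq_empty_or_nonempty (α := Fin d) with h | h
  · have : supNorm k = 0 := by simp [supNorm, h]
    rw [this]
    simpa using freq_nonneg k
  · obtain ⟨i, -, hi⟩ := Finset.exists_mem_eq_sup _ h fun i => (k i).valMinAbs.natAbs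
    have h1 := one_sub_wave_single k i
    have h2 : 1 - wave k (Pi.single i 1) ≤ ∑ e ∈ nbrs d n, (1 - wave k e) :=
      Finset.single_le_sum (f := fun e => 1 - wave k e)
        (fun e _ => sub_nonneg.2 (wave_le_one k e)) (single_mem_nbrs i)
    have h3 : (supNorm k : ℝ) = ((k i).valMinAbs.natAbs : ℝ) := by
      rw [supNorm, hi]
    rw [h3, freq]
    have h4 := mul_le_mul_of_nonneg_left (h1.trans h2) (by positivity : 0 ≤ 2 * (n : ℝ) ^ 2)
    refine le_trans (le_of_eq ?_) h4
    field_simp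
    ring

lemma card_supNorm_le (m : ℕ) :
    (Finset.univ.filter fun k : Site d n => supNorm k ≤ m).card ≤ (2 * m + 1) ^ d := by
  have hcard : (Finset.univ.filter fun c : ZMod n => c.valMinAbs.natAbs ≤ m).card
      ≤ 2 * m + 1 := by
    have := Finset.card_le_card_of_injOn (s := Finset.univ.filter
      fun c : ZMod n => c.valMinAbs.natAbs ≤ m) (t := Finset.Icc (-(m : ℤ)) m)
      (fun c => c.valMinAbs) (by
        intro c hc
        have : c.valMinAbs.natAbs ≤ m := by simpa using hc
        simp only [Finset.coe_Icc, Set.mem_Icc]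
        omega) (ZMod.injective_valMinAbs.injOn)
    refine this.trans ?_
    rw [Int.card_Icc]
    omega
  have : (Finset.univ.filter fun k : Site d n => supNorm k ≤ m)
      = Fintype.piFinset fun _ : Fin d =>
        Finset.univ.filter fun c : ZMod n => c.valMinAbs.natAbs ≤ m := by
    ext k
    simp [supNorm_le_iff]
  rw [this, Fintype.card_piFinset_const]
  exact Nat.pow_le_pow_left hcard d

end Fourier

/-! ### Green function of the killed difference walk -/

section Green

variable {d n : ℕ} [NeZero n]

/-- The Green function of the difference of two independent particles killed at rate `κ`. -/
noncomputable def green (κ : ℝ) (z : Site d n) : ℝ :=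
  ((n : ℝ) ^ d)⁻¹ * ∑ k : Site d n, wave k z / (κ + freq k)

lemma green_neg (κ : ℝ) (z : Site d n) : green κ (-z) = green κ z := by
  simp [green, wave_neg]

lemma abs_green_le {κ : ℝ} (hκ : 0 < κ) (z : Site d n) : |green κ z| ≤ green κ (0 : Site d n) := by
  rw [green, green, abs_mul, abs_of_nonneg (by positivity : 0 ≤ ((n : ℝ) ^ d)⁻¹)]
  refine mul_le_mul_of_nonneg_left ?_ (by positivity)
  refine (Finset.abs_sum_le_sum_abs _ _).trans (Finset.sum_le_sum fun k _ => ?_)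
  have := freq_nonneg k
  rw [abs_div, abs_of_pos (by linarith : 0 < κ + freq k), wave_zero]
  gcongr
  exact abs_wave_le k z

lemma green_equation {κ : ℝ} (hκ : 0 < κ) (z : Site d n) :
    2 * (n : ℝ) ^ 2 * ∑ e ∈ nbrs d n, (green κ (z + e) - green κ z)
      = κ * green κ z - if z = 0 then 1 else 0 := by
  have hn : (n : ℝ) ^ d ≠ 0 := pow_ne_zero _ (by exact_mod_cast NeZero.ne n)
  have hdelta : (if z = 0 then (1 : ℝ) else 0) = ((n : ℝ) ^ d)⁻¹ * ∑ k : Site d n, wave k z := by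
    rw [sum_wave]
    split_ifs
    · rw [inv_mul_cancel₀ hn]
    · simp
  have hk : ∀ k : Site d n, 2 * (n : ℝ) ^ 2 * ∑ e ∈ nbrs d n,
      (wave k (z + e) / (κ + freq k) - wave k z / (κ + freq k))
      = κ * (wave k z / (κ + freq k)) - wave k z := by
    intro k
    have hpos : κ + freq k ≠ 0 := by have := freq_nonneg k; positivity
    have h1 : ∑ e ∈ nbrs d n, (wave k (z + e) / (κ + freq k) - wave k z / (κ + freq k))
        = wave k z * (-∑ e ∈ nbrs d n, (1 - wave k e)) / (κ + freq k) := by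
      rw [Finset.sum_sub_distrib, ← Finset.sum_div, sum_nbrs_wave, Finset.sum_sub_distrib]
      simp only [Finset.sum_const]
      simp only [nsmul_eq_mul]
      ring
    have h2 : 2 * (n : ℝ) ^ 2 * (wave k z * (-∑ e ∈ nbrs d n, (1 - wave k e)) / (κ + freq k))
        = -(wave k z * freq k / (κ + freq k)) := by
      rw [freq]; ring
    rw [h1, h2]
    field_simp
    ring
  have hsum : ∑ e ∈ nbrs d n, (green κ (z + e) - green κ z)
      = ((n : ℝ) ^ d)⁻¹ * ∑ k : Site d n, ∑ e ∈ nbrs d n,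
        (wave k (z + e) / (κ + freq k) - wave k z / (κ + freq k)) := by
    rw [Finset.sum_comm, Finset.mul_sum]
    refine Finset.sum_congr rfl fun e _ => ?_
    rw [green, green, Finset.sum_sub_distrib, mul_sub]
  rw [hsum, hdelta, green, mul_left_comm, Finset.mul_sum, Finset.sum_congr rfl fun k _ => hk k,
    Finset.sum_sub_distrib, ← Finset.mul_sum]
  ring

lemma wave_comp (σ : Equiv.Perm (Fin d)) (k z : Site d n) :
    wave (k ∘ σ) (z ∘ σ) = wave k z := by
  rw [wave, wave, comp_equiv_dotProduct_comp_equiv]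

lemma comp_mem_nbrs (σ : Equiv.Perm (Fin d)) {e : Site d n} (he : e ∈ nbrs d n) :
    e ∘ σ ∈ nbrs d n := by
  rw [mem_nbrs] at he ⊢
  obtain ⟨i, hi⟩ := he
  have hs : (Pi.single i 1 : Site d n) ∘ σ = Pi.single (σ.symm i) 1 := by
    ext j
    simp [Pi.single_apply, Equiv.eq_symm_apply]
  refine ⟨σ.symm i, hi.imp (fun h => ?_) (fun h => ?_)⟩
  · rw [h, hs]
  · rw [h, ← hs]; rfl

lemma freq_comp (σ : Equiv.Perm (Fin d)) (k : Site d n) : freq (k ∘ σ) = freq k := by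
  rw [freq, freq]
  congr 1
  refine Finset.sum_bij' (fun e _ => e ∘ σ.symm) (fun e _ => e ∘ σ)
    (fun e h => comp_mem_nbrs σ.symm h) (fun e h => comp_mem_nbrs σ h) ?_ ?_ ?_
  · intro e _; ext; simp
  · intro e _; ext; simp
  · intro e _
    rw [← wave_comp σ k (e ∘ σ.symm)]
    congr 2
    ext; simp

lemma green_comp (κ : ℝ) (σ : Equiv.Perm (Fin d)) (z : Site d n) :
    green κ (z ∘ σ) = green κ z := by
  rw [green, green]
  congr 1
  refine (Fintype.sum_equiv (σ.symm.arrowCongr (Equiv.refl (ZMod n))) _ _ fun k => ?_).symm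
  change _ = wave (k ∘ σ) (z ∘ σ) / (κ + freq (k ∘ σ))
  rw [wave_comp, freq_comp]

/-- Reflection and permutations of the coordinates act transitively on the neighbours of the origin
and preserve the Green function. The Green equation at the origin then determines the gap to each
single neighbour. -/
lemma green_eq_of_mem_nbrs (κ : ℝ) {e e' : Site d n} (he : e ∈ nbrs d n) (he' : e' ∈ nbrs d n) :
    green κ e = green κ e' := by
  have hs : ∀ {e : Site d n}, e ∈ nbrs d n → ∃ i, green κ e = green κ (Pi.single i 1 : Site d n) := by
    intro e he
    obtain ⟨i, rfl | rfl⟩ := mem_nbrs.1 he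
    · exact ⟨i, rfl⟩
    · exact ⟨i, green_neg κ _⟩
  obtain ⟨i, hi⟩ := hs he
  obtain ⟨j, hj⟩ := hs he'
  rw [hi, hj, ← green_comp κ (Equiv.swap i j)]
  congr 1
  ext l
  simp only [Function.comp_apply, Pi.single_apply]
  congr 1
  rw [Equiv.swap_apply_eq_iff, Equiv.swap_apply_left]

lemma mul_green_zero_eq (κ : ℝ) (hκ : 0 < κ) : κ * green κ (0 : Site d n)
    = ((n : ℝ) ^ d)⁻¹ * (1 + ∑ k : Site d n with k ≠ 0, κ / (κ + freq k)) := by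
  have h0 : (Finset.univ.filter fun k : Site d n => ¬ k ≠ 0) = {0} := by ext; simp
  rw [green, mul_left_comm, Finset.mul_sum,
    ← Finset.sum_filter_add_sum_filter_not Finset.univ (fun k : Site d n => k ≠ 0), h0,
    Finset.sum_singleton, wave_zero, freq_zero, add_zero, mul_one_div_cancel hκ.ne', add_comm]
  simp only [wave_zero, mul_one_div]

lemma sixteen_le_freq {k : Site d n} (hk : k ≠ 0) : 16 ≤ freq k := by
  have h1 : (1 : ℝ) ≤ supNorm k := by exact_mod_cast one_le_supNorm hk
  nlinarith [supNorm_sq_le_freq k]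

/-- The zero mode contributes `n ^ (-d) ≤ 1 / 2`, and the other modes, each at most `1 / 16` because
`freq k ≥ 16` and `κ ≤ 1`, average to at most `1 / 16`. -/
lemma mul_green_zero_le {κ : ℝ} (hκ : 0 < κ) (hκ1 : κ ≤ 1) (hd : 1 ≤ d) (hn : 2 ≤ n) :
    κ * green κ (0 : Site d n) ≤ 3 / 4 := by
  have hn' : (2 : ℝ) ≤ n := by exact_mod_cast hn
  have hnd : (2 : ℝ) ≤ (n : ℝ) ^ d := hn'.trans (le_self_pow₀ (by linarith) (by omega))
  rw [mul_green_zero_eq κ hκ]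
  have h1 : ∑ k : Site d n with k ≠ 0, κ / (κ + freq k) ≤ (n : ℝ) ^ d * (1 / 16) := by
    refine (Finset.sum_le_card_nsmul _ _ (1 / 16) fun k hk => ?_).trans ?_
    · have := sixteen_le_freq (Finset.mem_filter.1 hk).2
      rw [div_le_div_iff₀ (by linarith) (by norm_num)]
      linarith
    · rw [nsmul_eq_mul]
      gcongr
      have := Finset.card_filter_le (Finset.univ : Finset (Site d n)) (fun k => k ≠ 0)
      have h2 : (Finset.univ : Finset (Site d n)).card = n ^ d := by
        simp [ZMod.card]
      rw [h2] at this
      exact_mod_cast this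
  rw [inv_mul_le_iff₀ (by linarith)]
  linarith

/-- By symmetry the Green equation at the origin says that the number of neighbours times the
right-hand side is `1 - κ * G(0) ≥ 1 / 4`; there are at most `2 * d` neighbours. -/
lemma green_gap {κ : ℝ} (hκ : 0 < κ) (hκ1 : κ ≤ 1) (hd : 1 ≤ d) (hn : 2 ≤ n) {e : Site d n}
    (he : e ∈ nbrs d n) : 1 / (8 * d) ≤ 2 * (n : ℝ) ^ 2 * (green κ (0 : Site d n) - green κ e) := by
  have h := green_equation hκ (0 : Site d n)
  have hc : ∑ e' ∈ nbrs d n, (green κ (0 + e') - green κ (0 : Site d n))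
      = (nbrs d n).card * (green κ e - green κ (0 : Site d n)) := by
    rw [← nsmul_eq_mul, ← Finset.sum_const]
    exact Finset.sum_congr rfl fun e' he' => by rw [zero_add, green_eq_of_mem_nbrs κ he' he]
  rw [hc, if_pos rfl] at h
  have h2 := mul_green_zero_le (d := d) hκ hκ1 hd hn
  have h3 : ((nbrs d n).card : ℝ) ≤ 2 * d := by exact_mod_cast card_nbrs_le
  have h4 : 0 ≤ green κ (0 : Site d n) - green κ e := by
    linarith [(abs_le.1 (abs_green_le hκ e)).2]
  have h5 : ((nbrs d n).card : ℝ) * (2 * (n : ℝ) ^ 2 * (green κ (0 : Site d n) - green κ e))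
      ≤ 2 * d * (2 * (n : ℝ) ^ 2 * (green κ (0 : Site d n) - green κ e)) := by gcongr
  have hd' : (0 : ℝ) < d := by exact_mod_cast hd
  rw [div_le_iff₀ (by positivity)]
  linarith

end Green

/-! ### Lattice sums and the dimension-dependent rate -/

section LatticeSum

lemma one_le_two_mul_g {d n : ℕ} (hn : 2 ≤ n) : 1 ≤ 2 * g d n := by
  have hn' : (2 : ℝ) ≤ n := by exact_mod_cast hn
  unfold g
  split_ifs
  · linarith
  · have := Real.log_le_log (by norm_num) hn'
    linarith [Real.log_two_gt_d9]
  · norm_num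

lemma g_pos {d n : ℕ} (hn : 2 ≤ n) : 0 < g d n := by
  linarith [one_le_two_mul_g (d := d) hn]

/-- Absorbs the two contributions of order `n ^ (-d)`: the zero Fourier mode and the overlapping
translates in the second moment. -/
lemma inv_pow_le_g {d n : ℕ} (hd : 1 ≤ d) (hn : 2 ≤ n) :
    ((n : ℝ) ^ d)⁻¹ ≤ 2 * (g d n / (n : ℝ) ^ 2) := by
  have hn' : (2 : ℝ) ≤ n := by exact_mod_cast hn
  rw [inv_eq_one_div, ← mul_div_assoc, div_le_div_iff₀ (by positivity) (by positivity), one_mul]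
  rcases Nat.lt_or_ge d 2 with h | h
  · obtain rfl : d = 1 := by omega
    simp only [g, if_true, pow_one]
    nlinarith
  · have := one_le_two_mul_g (d := d) hn
    have h2 : (n : ℝ) ^ 2 ≤ (n : ℝ) ^ d := pow_le_pow_right₀ (by linarith) h
    have : 1 * (n : ℝ) ^ d ≤ 2 * g d n * (n : ℝ) ^ d := by gcongr
    linarith

/-- The three regimes of `g` come from the sum of `m ^ (d - 3)`: bounded for `d = 1`, logarithmic
for `d = 2`, at most `n ^ (d - 2)` for `d ≥ 3`. -/
lemma sum_pow_div_cube_le {d n : ℕ} (hd : 1 ≤ d) (hn : 2 ≤ n) :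
    ((n : ℝ) ^ d)⁻¹ * ∑ m ∈ Finset.Ico 1 n, (m : ℝ) ^ d / (m : ℝ) ^ 3
      ≤ 3 * (g d n / (n : ℝ) ^ 2) := by
  have hn' : (2 : ℝ) ≤ n := by exact_mod_cast hn
  have hpos : ∀ m ∈ Finset.Ico 1 n, (0 : ℝ) < m := fun m hm => by
    exact_mod_cast (Finset.mem_Ico.1 hm).1
  rw [inv_mul_le_iff₀ (by positivity)]
  rcases Nat.lt_or_ge d 3 with h | h
  · obtain rfl | rfl : d = 1 ∨ d = 2 := by omega
    · have h1 : ∑ m ∈ Finset.Ico 1 n, (m : ℝ) ^ 1 / (m : ℝ) ^ 3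
          = ∑ m ∈ Finset.Ioo 0 n, ((m : ℝ) ^ 2)⁻¹ := by
        refine Finset.sum_congr rfl fun m hm => ?_
        have := hpos m hm
        field_simp
      have h2 := sum_Ioo_inv_sq_le (α := ℝ) 0 n
      rw [h1]
      have h3 : (n : ℝ) ^ 1 * (3 * (g 1 n / (n : ℝ) ^ 2)) = 3 := by
        simp only [g, if_true]
        field_simp
      rw [h3]
      norm_num at h2
      linarith
    · have h1 : ∑ m ∈ Finset.Ico 1 n, (m : ℝ) ^ 2 / (m : ℝ) ^ 3
          ≤ ∑ m ∈ Finset.Icc 1 n, (m : ℝ)⁻¹ := by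
        refine (Finset.sum_le_sum_of_subset_of_nonneg (Finset.Ico_subset_Icc_self)
          fun _ _ _ => by positivity).trans (Finset.sum_le_sum fun m hm => ?_)
        have : (0 : ℝ) < m := by exact_mod_cast (Finset.mem_Icc.1 hm).1
        apply le_of_eq
        field_simp
      have h2 := harmonic_le_one_add_log n
      rw [harmonic_eq_sum_Icc] at h2
      push_cast at h2
      have h3 : (n : ℝ) ^ 2 * (3 * (g 2 n / (n : ℝ) ^ 2)) = 3 * Real.log n := by
        simp only [g]
        norm_num
        field_simp
      rw [h3]
      have h4 := one_le_two_mul_g (d := 2) hn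
      simp only [g] at h4
      norm_num at h4
      linarith
  · have h1 : ∑ m ∈ Finset.Ico 1 n, (m : ℝ) ^ d / (m : ℝ) ^ 3 ≤ n * (n : ℝ) ^ (d - 3) := by
      refine (Finset.sum_le_card_nsmul _ _ ((n : ℝ) ^ (d - 3)) fun m hm => ?_).trans ?_
      · have hm0 := hpos m hm
        have hmn : (m : ℝ) ≤ n := by exact_mod_cast (Finset.mem_Ico.1 hm).2.le
        rw [div_eq_mul_inv, ← pow_sub₀ _ hm0.ne' h]
        gcongr
      · rw [nsmul_eq_mul]
        gcongr
        simp
    have h2 : (n : ℝ) ^ d = n ^ (d - 3) * n ^ 3 := by rw [← pow_add]; congr 1; omega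
    have h3 : g d n = 1 := by
      simp only [g]
      rw [if_neg (by omega), if_neg (by omega)]
    have h4 : (n : ℝ) ^ d * (3 * (g d n / (n : ℝ) ^ 2)) = 3 * (n * (n : ℝ) ^ (d - 3)) := by
      rw [h2, h3]
      field_simp
    rw [h4]
    have : 0 ≤ (n : ℝ) * (n : ℝ) ^ (d - 3) := by positivity
    linarith

/-- A discrete layer-cake formula: it turns a sum of `1 / |k| ^ 2` into counts of the boxes `|k| ≤
m` weighted by `2 / m ^ 3`, so that no spheres need to be counted. -/
lemma inv_sq_le_sum {N n : ℕ} (hN : 1 ≤ N) (hNn : N ≤ n) :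
    1 / (N : ℝ) ^ 2 ≤ ∑ m ∈ Finset.Ico N n, 2 / (m : ℝ) ^ 3 + 1 / (n : ℝ) ^ 2 := by
  induction n, hNn using Nat.le_induction with
  | base => simp
  | succ n hn ih =>
    rw [Finset.sum_Ico_succ_top hn]
    have hn0 : (0 : ℝ) < n := by exact_mod_cast hN.trans hn
    have : 1 / (n : ℝ) ^ 2 ≤ 2 / (n : ℝ) ^ 3 + 1 / ((n + 1 : ℕ) : ℝ) ^ 2 := by
      push_cast
      rw [div_add_div _ _ (by positivity) (by positivity),
        div_le_div_iff₀ (by positivity) (by positivity)]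
      have h1 : 0 ≤ (n : ℝ) ^ 3 := by positivity
      have h2 : 0 ≤ (n : ℝ) ^ 2 := by positivity
      nlinarith [mul_nonneg h2 hn0.le, mul_nonneg h1 hn0.le]
    linarith

variable {d n : ℕ} [NeZero n]

lemma sum_inv_supNorm_sq_le :
    ∑ k : Site d n with k ≠ 0, 1 / (supNorm k : ℝ) ^ 2
      ≤ 2 * 3 ^ d * (∑ m ∈ Finset.Ico 1 n, (m : ℝ) ^ d / (m : ℝ) ^ 3)
        + (n : ℝ) ^ d / (n : ℝ) ^ 2 := by
  have h1 : ∀ k : Site d n, k ≠ 0 → 1 / (supNorm k : ℝ) ^ 2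
      ≤ (∑ m ∈ Finset.Ico 1 n, if supNorm k ≤ m then 2 / (m : ℝ) ^ 3 else 0)
        + 1 / (n : ℝ) ^ 2 := by
    intro k hk
    refine (inv_sq_le_sum (one_le_supNorm hk) (supNorm_le k)).trans (le_of_eq ?_)
    rw [← Finset.sum_filter]
    congr 2
    ext m
    simp only [Finset.mem_Ico, Finset.mem_filter]
    have := one_le_supNorm hk
    omega
  have h2 : ∑ k : Site d n with k ≠ 0, 1 / (supNorm k : ℝ) ^ 2
      ≤ ∑ k : Site d n, ((∑ m ∈ Finset.Ico 1 n, if supNorm k ≤ m then 2 / (m : ℝ) ^ 3 else 0)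
        + 1 / (n : ℝ) ^ 2) := by
    refine (Finset.sum_le_sum fun k hk => h1 k (Finset.mem_filter.1 hk).2).trans ?_
    refine Finset.sum_le_sum_of_subset_of_nonneg (Finset.filter_subset _ _) fun k _ _ => ?_
    refine add_nonneg (Finset.sum_nonneg fun m _ => ?_) (by positivity)
    split_ifs <;> positivity
  refine h2.trans ?_
  rw [Finset.sum_add_distrib, Finset.sum_comm]
  refine add_le_add ?_ (le_of_eq ?_)
  · rw [Finset.mul_sum]
    refine Finset.sum_le_sum fun m hm => ?_
    have hm0 : (1 : ℝ) ≤ m := by exact_mod_cast (Finset.mem_Ico.1 hm).1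
    rw [← Finset.sum_filter, Finset.sum_const, nsmul_eq_mul]
    have hc : (((Finset.univ.filter fun k : Site d n => supNorm k ≤ m).card : ℕ) : ℝ)
        ≤ (2 * m + 1) ^ d := by exact_mod_cast card_supNorm_le m
    have hc2 : ((2 * m + 1 : ℝ)) ^ d ≤ (3 * m) ^ d := by
      gcongr
      linarith
    calc _ ≤ (3 * (m : ℝ)) ^ d * (2 / (m : ℝ) ^ 3) := by gcongr; exact hc.trans hc2
      _ = _ := by rw [mul_pow]; ring
  · simp [ZMod.card, div_eq_mul_inv]

lemma mul_green_zero_le_g {κ : ℝ} (hκ : 0 < κ) (hκ1 : κ ≤ 1) (hd : 1 ≤ d) (hn : 2 ≤ n) :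
    κ * green κ (0 : Site d n) ≤ (3 + 3 ^ d) * (g d n / (n : ℝ) ^ 2) := by
  have hn' : (2 : ℝ) ≤ n := by exact_mod_cast hn
  have h1 : ∑ k : Site d n with k ≠ 0, κ / (κ + freq k)
      ≤ (1 / 16) * ∑ k : Site d n with k ≠ 0, 1 / (supNorm k : ℝ) ^ 2 := by
    rw [Finset.mul_sum]
    refine Finset.sum_le_sum fun k hk => ?_
    have h0 : (1 : ℝ) ≤ supNorm k := by exact_mod_cast one_le_supNorm (Finset.mem_filter.1 hk).2
    have := supNorm_sq_le_freq k
    have h2 : (0 : ℝ) < (supNorm k : ℝ) ^ 2 := by positivity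
    rw [div_mul_div_comm, div_le_div_iff₀ (by linarith) (by positivity)]
    nlinarith
  have h2 := sum_inv_supNorm_sq_le (d := d) (n := n)
  have h3 := inv_pow_le_g hd hn
  have h4 := sum_pow_div_cube_le hd hn
  have h5 := one_le_two_mul_g (d := d) hn
  rw [mul_green_zero_eq κ hκ]
  set S := ∑ m ∈ Finset.Ico 1 n, (m : ℝ) ^ d / (m : ℝ) ^ 3
  set q := ((n : ℝ) ^ d)⁻¹
  have hq : 0 ≤ q := by positivity
  have h6 : 1 + ∑ k : Site d n with k ≠ 0, κ / (κ + freq k)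
      ≤ 1 + (1 / 16) * (2 * 3 ^ d * S + (n : ℝ) ^ d / (n : ℝ) ^ 2) := by linarith
  have h7 : q * ((n : ℝ) ^ d / (n : ℝ) ^ 2) ≤ 2 * (g d n / (n : ℝ) ^ 2) := by
    have : q * ((n : ℝ) ^ d / (n : ℝ) ^ 2) = 1 / (n : ℝ) ^ 2 := by
      simp only [q]; field_simp
    rw [this, ← mul_div_assoc]
    gcongr
  have h8 := mul_le_mul_of_nonneg_left h4 (by positivity : (0 : ℝ) ≤ 3 ^ d)
  have h9 := mul_le_mul_of_nonneg_left h6 hq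
  have h10 : (0 : ℝ) ≤ 3 ^ d * (g d n / (n : ℝ) ^ 2) := by
    have := g_pos (d := d) hn
    positivity
  refine h9.trans ?_
  nlinarith

end LatticeSum

/-! ### Linearity and monotonicity of expectations -/

section Expectation

variable {d n : ℕ} [NeZero n]

lemma expect_add (μ h h' : Config d n → ℝ) :
    expect μ (fun η => h η + h' η) = expect μ h + expect μ h' := by
  simp [expect, mul_add, Finset.sum_add_distrib]

lemma expect_sub (μ h h' : Config d n → ℝ) :
    expect μ (fun η => h η - h' η) = expect μ h - expect μ h' := by
  simp [expect, mul_sub, Finset.sum_sub_distrib]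

lemma expect_const_mul (μ : Config d n → ℝ) (r : ℝ) (h : Config d n → ℝ) :
    expect μ (fun η => r * h η) = r * expect μ h := by
  simp only [expect, Finset.mul_sum]
  exact Finset.sum_congr rfl fun _ _ => by ring

lemma expect_sum {ι : Type*} (μ : Config d n → ℝ) (s : Finset ι) (h : ι → Config d n → ℝ) :
    expect μ (fun η => ∑ i ∈ s, h i η) = ∑ i ∈ s, expect μ (h i) := by
  simp only [expect, Finset.mul_sum]
  rw [Finset.sum_comm]

lemma expect_mono {μ h h' : Config d n → ℝ} (hμ : ∀ η, 0 ≤ μ η) (hh : ∀ η, h η ≤ h' η) :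
    expect μ h ≤ expect μ h' :=
  Finset.sum_le_sum fun η _ => mul_le_mul_of_nonneg_left (hh η) (hμ η)

lemma expect_const {μ : Config d n → ℝ} (hμ : μ ∈ stdSimplex ℝ (Config d n)) (r : ℝ) :
    expect μ (fun _ => r) = r := by
  rw [expect, ← Finset.sum_mul, hμ.2, one_mul]

lemma abs_expect_le {μ h : Config d n → ℝ} (hμ : μ ∈ stdSimplex ℝ (Config d n)) {B : ℝ}
    (hB : ∀ η, |h η| ≤ B) : |expect μ h| ≤ B := by
  rw [abs_le]
  constructor
  · rw [← expect_const hμ (-B)]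
    exact expect_mono hμ.1 fun η => (abs_le.1 (hB η)).1
  · rw [← expect_const hμ B]
    exact expect_mono hμ.1 fun η => (abs_le.1 (hB η)).2

end Expectation

/-! ### Centred correlations and the moment hierarchy -/

section Correlations

variable {d n : ℕ}

lemma occ_mul_self (η : Config d n) (x : Site d n) : occ η x * occ η x = occ η x := by
  unfold occ; split_ifs <;> simp

lemma occ_flip_self (η : Config d n) (x : Site d n) : occ (flip η x) x = 1 - occ η x := by
  unfold occ flip; cases η x <;> simp

lemma occ_flip_of_ne (η : Config d n) {x z : Site d n} (h : z ≠ x) :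
    occ (flip η x) z = occ η z := by
  simp [occ, flip, h]

/-- The product over `A` of the centred occupation numbers. -/
noncomputable def centred (ρ : ℝ) (A : Finset (Site d n)) (η : Config d n) : ℝ :=
  ∏ x ∈ A, (occ η x - ρ)

lemma centred_empty (ρ : ℝ) (η : Config d n) : centred ρ ∅ η = 1 := by simp [centred]

lemma centred_insert (ρ : ℝ) {A : Finset (Site d n)} {x : Site d n} (hx : x ∉ A)
    (η : Config d n) : centred ρ (insert x A) η = (occ η x - ρ) * centred ρ A η := by
  rw [centred, Finset.prod_insert hx, centred]

lemma centred_union (ρ : ℝ) {A B : Finset (Site d n)} (h : Disjoint A B) (η : Config d n) :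
    centred ρ (A ∪ B) η = centred ρ A η * centred ρ B η := by
  rw [centred, Finset.prod_union h, centred, centred]

lemma centred_erase (ρ : ℝ) {A : Finset (Site d n)} {x : Site d n} (hx : x ∈ A)
    (η : Config d n) : (occ η x - ρ) * centred ρ (A.erase x) η = centred ρ A η :=
  Finset.mul_prod_erase A (fun x => occ η x - ρ) hx

lemma abs_centred_le {ρ : ℝ} (hρ : ρ ∈ Set.Icc (0 : ℝ) 1) (A : Finset (Site d n))
    (η : Config d n) : |centred ρ A η| ≤ 1 := by
  rw [centred, Finset.abs_prod]
  refine Finset.prod_le_one (fun _ _ => abs_nonneg _) fun x _ => ?_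
  obtain ⟨h0, h1⟩ := hρ
  unfold occ
  split_ifs <;> rw [abs_le] <;> constructor <;> linarith

lemma centred_exchange (ρ : ℝ) (A : Finset (Site d n)) (η : Config d n) (x y : Site d n) :
    centred ρ A (exchange η x y) = centred ρ (A.map (Equiv.swap x y).toEmbedding) η := by
  rw [centred, centred, Finset.prod_map]
  rfl

lemma centred_flip_of_notMem (ρ : ℝ) {A : Finset (Site d n)} {x : Site d n} (hx : x ∉ A)
    (η : Config d n) : centred ρ A (flip η x) = centred ρ A η :=
  Finset.prod_congr rfl fun z hz => by
    rw [occ_flip_of_ne]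
    rintro rfl
    exact hx hz

lemma centred_flip_sub (ρ : ℝ) {A : Finset (Site d n)} {x : Site d n} (hx : x ∈ A)
    (η : Config d n) :
    centred ρ A (flip η x) - centred ρ A η = (1 - 2 * occ η x) * centred ρ (A.erase x) η := by
  rw [← centred_erase ρ hx, ← centred_erase ρ hx η, occ_flip_self,
    centred_flip_of_notMem ρ (Finset.notMem_erase x A)]
  ring

variable [NeZero n]

/-- Once the neighbours are centred, what remains is affine in `occ η x`, with slope `-(a + b + lam
* ρ)` and value `reaction a b lam ρ = 0` at `ρ`. Hence there is no constant term. -/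
lemma rate_mul_one_sub {a b lam ρ : ℝ} (hd : 1 ≤ d) (hn : 3 ≤ n)
    (hρ : reaction a b lam ρ = 0) (x : Site d n) (η : Config d n) :
    rate a b lam x η * (1 - 2 * occ η x) = -(a + b + lam * ρ) * (occ η x - ρ)
      + lam / (2 * d) * ∑ e ∈ nbrs d n, (1 - occ η x) * (occ η (x + e) - ρ) := by
  have hd' : (d : ℝ) ≠ 0 := by positivity
  rw [rate, sum_nbr, ← Finset.mul_sum, Finset.sum_sub_distrib, Finset.sum_const, card_nbrs hn,
    nsmul_eq_mul]
  push_cast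
  set s := ∑ e ∈ nbrs d n, occ η (x + e)
  set o := occ η x with ho
  have h1 : o * o = o := occ_mul_self η x
  have h2 : lam / (2 * d) * ((1 - o) * (s - 2 * d * ρ))
      = (1 - o) * (lam / (2 * d) * s) - (1 - o) * lam * ρ := by
    field_simp
  rw [h2]
  set t := lam / (2 * d) * s
  unfold reaction at hρ
  linear_combination (2 * (a + t) - 2 * b) * h1 + hρ

/-- The correlation function of the centred occupation numbers. -/
noncomputable def corr (μ : Config d n → ℝ) (ρ : ℝ) (A : Finset (Site d n)) : ℝ :=
  expect μ (centred ρ A)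

/-- The contribution of the pair `x`, `y` to the interaction part of the moment equations. -/
noncomputable def interaction (μ : Config d n → ℝ) (ρ : ℝ) (A : Finset (Site d n))
    (x y : Site d n) : ℝ :=
  expect μ fun η => (1 - occ η x) * (occ η y - ρ) * centred ρ (A.erase x) η

lemma genReact_centred {a b lam ρ : ℝ} (hd : 1 ≤ d) (hn : 3 ≤ n) (hρ : reaction a b lam ρ = 0)
    (A : Finset (Site d n)) (η : Config d n) :
    genReact a b lam (centred ρ A) η = ∑ x ∈ A, (-(a + b + lam * ρ) * centred ρ A η
      + lam / (2 * d) * ∑ e ∈ nbrs d n,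
        (1 - occ η x) * (occ η (x + e) - ρ) * centred ρ (A.erase x) η) := by
  rw [genReact, ← Finset.sum_subset (Finset.subset_univ A)]
  · refine Finset.sum_congr rfl fun x hx => ?_
    rw [centred_flip_sub ρ hx, ← mul_assoc, rate_mul_one_sub hd hn hρ, ← centred_erase ρ hx η,
      ← Finset.sum_mul]
    ring
  · intro x _ hx
    rw [centred_flip_of_notMem ρ hx, sub_self, mul_zero]

lemma genEx_centred (ρ : ℝ) (A : Finset (Site d n)) (η : Config d n) :
    genEx (centred ρ A) η = (n : ℝ) ^ 2 * ((1 / 2) * ∑ x : Site d n, ∑ e ∈ nbrs d n,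
      (centred ρ (A.map (Equiv.swap x (x + e)).toEmbedding) η - centred ρ A η)) := by
  rw [genEx]
  congr 2
  refine Finset.sum_congr rfl fun x _ => ?_
  rw [sum_nbr x fun y => centred ρ A (exchange η x y) - centred ρ A η]
  simp only [centred_exchange]

lemma moment_equation {a b lam ρ : ℝ} (hd : 1 ≤ d) (hn : 3 ≤ n) (hρ : reaction a b lam ρ = 0)
    {μ : Config d n → ℝ} (hμ : IsStationary a b lam μ) (A : Finset (Site d n)) :
    (n : ℝ) ^ 2 * ((1 / 2) * ∑ x : Site d n, ∑ e ∈ nbrs d n,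
      (corr μ ρ (A.map (Equiv.swap x (x + e)).toEmbedding) - corr μ ρ A))
    + ∑ x ∈ A, (-(a + b + lam * ρ) * corr μ ρ A
      + lam / (2 * d) * ∑ e ∈ nbrs d n, interaction μ ρ A x (x + e)) = 0 := by
  rw [← hμ.2 (centred ρ A)]
  have h : gen a b lam (centred ρ A) = fun η => genEx (centred ρ A) η
      + genReact a b lam (centred ρ A) η := rfl
  rw [h, expect_add]
  congr 1
  · rw [funext (genEx_centred ρ A), expect_const_mul, expect_const_mul, expect_sum]
    congr 2
    refine Finset.sum_congr rfl fun x _ => ?_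
    rw [expect_sum]
    exact Finset.sum_congr rfl fun e _ => by rw [expect_sub]; rfl
  · rw [funext (genReact_centred hd hn hρ A), expect_sum]
    refine Finset.sum_congr rfl fun x _ => ?_
    rw [expect_add, expect_const_mul, expect_const_mul, expect_sum]
    rfl

lemma corr_empty {μ : Config d n → ℝ} (hμ : μ ∈ stdSimplex ℝ (Config d n)) (ρ : ℝ) :
    corr μ ρ ∅ = 1 := by
  rw [corr, funext (centred_empty ρ), expect_const hμ]

lemma interaction_of_notMem (μ : Config d n → ℝ) (ρ : ℝ) {A : Finset (Site d n)}
    {x y : Site d n} (hx : x ∈ A) (hy : y ∉ A) :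
    interaction μ ρ A x y
      = (1 - ρ) * corr μ ρ (insert y (A.erase x)) - corr μ ρ (insert y A) := by
  rw [corr, corr, ← expect_const_mul, ← expect_sub, interaction]
  congr 1
  ext η
  rw [centred_insert ρ hy, centred_insert ρ (fun h => hy (Finset.mem_of_mem_erase h)),
    ← centred_erase ρ hx η]
  ring

/-- The square is linearised by `(occ η y - ρ) ^ 2 = ρ * (1 - ρ) + (1 - 2 * ρ) * (occ η y - ρ)`. The
set `B`, which has lost both points, may be empty. -/
lemma interaction_insert (μ : Config d n → ℝ) (ρ : ℝ) {B : Finset (Site d n)}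
    {x y : Site d n} (hxy : x ≠ y) (hx : x ∉ B) (hy : y ∉ B) :
    interaction μ ρ (insert x (insert y B)) x y
      = (1 - ρ) * (ρ * (1 - ρ)) * corr μ ρ B + (1 - ρ) * (1 - 2 * ρ) * corr μ ρ (insert y B)
        - ρ * (1 - ρ) * corr μ ρ (insert x B)
        - (1 - 2 * ρ) * corr μ ρ (insert x (insert y B)) := by
  have hx' : x ∉ insert y B := by simp [hxy, hx]
  simp only [corr]
  rw [← expect_const_mul, ← expect_const_mul, ← expect_const_mul, ← expect_const_mul,
    ← expect_add, ← expect_sub, ← expect_sub, interaction, Finset.erase_insert hx']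
  congr 1
  ext η
  rw [centred_insert ρ hx', centred_insert ρ hy, centred_insert ρ hx]
  linear_combination (1 - occ η x) * centred ρ B η * occ_mul_self η y

/-- At most four correlations occur, with coefficients at most 1 in absolute value. The empty set is
among them only for `A = {x, y}`, and this is the sole source in the hierarchy. -/
lemma abs_interaction_le {μ : Config d n → ℝ} (hμ : μ ∈ stdSimplex ℝ (Config d n)) {ρ M : ℝ}
    (hρ : ρ ∈ Set.Icc (0 : ℝ) 1) (hM : ∀ B : Finset (Site d n), B.Nonempty → |corr μ ρ B| ≤ M)
    {A : Finset (Site d n)} {x y : Site d n} (hx : x ∈ A) (hxy : x ≠ y) :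
    |interaction μ ρ A x y| ≤ 4 * M + if A = {x, y} then 1 else 0 := by
  obtain ⟨h0, h1⟩ := hρ
  have hM0 : 0 ≤ M := (abs_nonneg _).trans (hM A ⟨x, hx⟩)
  have key : ∀ r : ℝ, |r| ≤ 1 → ∀ B : Finset (Site d n), B.Nonempty →
      |r * corr μ ρ B| ≤ M := by
    intro r hr B hB
    rw [abs_mul]
    nlinarith [hM B hB, abs_nonneg (corr μ ρ B), abs_nonneg r]
  have hone : |1 - ρ| ≤ 1 := by rw [abs_le]; constructor <;> linarith
  have htwo : |1 - 2 * ρ| ≤ 1 := by rw [abs_le]; constructor <;> linarith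
  have hvar : |ρ * (1 - ρ)| ≤ 1 := by rw [abs_le]; constructor <;> nlinarith
  have hprod : ∀ r s : ℝ, |r| ≤ 1 → |s| ≤ 1 → |r * s| ≤ 1 := fun r s hr hs => by
    rw [abs_mul]; exact mul_le_one₀ hr (abs_nonneg _) hs
  by_cases hy : y ∈ A
  · obtain ⟨B, hxB, hyB, rfl⟩ : ∃ B : Finset (Site d n), x ∉ B ∧ y ∉ B ∧
        A = insert x (insert y B) := by
      refine ⟨(A.erase x).erase y, by simp, by simp, ?_⟩
      rw [Finset.insert_erase (Finset.mem_erase.2 ⟨hxy.symm, hy⟩), Finset.insert_erase hx]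
    rw [interaction_insert μ ρ hxy hxB hyB]
    have e2 := key _ (hprod _ _ hone htwo) (insert y B) (Finset.insert_nonempty _ _)
    have e3 := key _ hvar (insert x B) (Finset.insert_nonempty _ _)
    have e4 := key _ htwo (insert x (insert y B)) (Finset.insert_nonempty _ _)
    have e1 : |(1 - ρ) * (ρ * (1 - ρ)) * corr μ ρ B|
        ≤ M + if insert x (insert y B) = {x, y} then 1 else 0 := by
      rcases B.eq_empty_or_nonempty with rfl | hB
      · rw [corr_empty hμ, mul_one, if_pos (by simp)]
        linarith [hprod _ _ hone hvar]
      · have := key _ (hprod _ _ hone hvar) B hB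
        split_ifs <;> linarith
    rw [abs_le] at *
    constructor <;> linarith [e1.1, e1.2, e2.1, e2.2, e3.1, e3.2, e4.1, e4.2]
  · rw [interaction_of_notMem μ ρ hx hy]
    have e1 := key _ hone (insert y (A.erase x)) (Finset.insert_nonempty _ _)
    have e2 := hM (insert y A) (Finset.insert_nonempty _ _)
    have e3 : (0 : ℝ) ≤ if A = {x, y} then 1 else 0 := by split_ifs <;> norm_num
    rw [abs_le] at *
    constructor <;> linarith [e1.1, e1.2, e2.1, e2.2]

end Correlations

/-! ### Two exclusion particles and their Green function -/

section PairExchange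

variable {d n : ℕ} [NeZero n]

/-- The difference of two exclusion particles is a random walk whose jumps to the origin are
suppressed: exchanging two occupied sites only reverses the difference, which the even `v` ignores.
The factor 4 counts the two particles and the two orders of each bond. -/
lemma sum_swap_pair (hn : 2 ≤ n) {v : Site d n → ℝ} (hv : ∀ z, v (-z) = v z) {p q : Site d n}
    (hpq : p ≠ q) :
    ∑ x : Site d n, ∑ e ∈ nbrs d n,
      (v (Equiv.swap x (x + e) p - Equiv.swap x (x + e) q) - v (p - q))
    = 4 * ∑ e ∈ nbrs d n, if p - q + e = 0 then 0 else v (p - q + e) - v (p - q) := by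
  set S : Site d n → ℝ := fun y => if y = q then 0 else v (y - q) - v (p - q) with hS
  set T : Site d n → ℝ := fun y => if y = p then 0 else v (p - y) - v (p - q) with hT
  have hsplit : ∀ x, ∀ e ∈ nbrs d n,
      v (Equiv.swap x (x + e) p - Equiv.swap x (x + e) q) - v (p - q)
      = (if x = p then S (x + e) else 0) + (if x + e = p then S x else 0)
        + (if x = q then T (x + e) else 0) + (if x + e = q then T x else 0) := by
    intro x e he
    have he0 : x + e ≠ x := fun h => zero_notMem_nbrs hn (by
      rwa [← left_eq_add.1 h.symm])
    generalize x + e = y at he0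
    by_cases hxp : x = p
    · subst hxp
      by_cases hyq : y = q
      · subst hyq
        have : v (y - x) = v (x - y) := by rw [← hv, neg_sub]
        simp [hS, hT, hpq, he0, this]
      · have : Equiv.swap x y q = q := Equiv.swap_apply_of_ne_of_ne hpq.symm (Ne.symm hyq)
        simp [hS, hpq, hyq, he0, this]
    · by_cases hxq : x = q
      · subst hxq
        by_cases hyp : y = p
        · subst hyp
          have : v (x - y) = v (y - x) := by rw [← hv, neg_sub]
          simp [hS, hT, hpq.symm, he0, this]
        · have : Equiv.swap x y p = p := Equiv.swap_apply_of_ne_of_ne hpq (Ne.symm hyp)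
          simp [hT, hpq.symm, hyp, he0, this]
      · by_cases hyp : y = p
        · subst hyp
          have : Equiv.swap x y q = q := Equiv.swap_apply_of_ne_of_ne (Ne.symm hxq) hpq.symm
          simp [hS, hxp, hxq, hpq, this]
        · by_cases hyq : y = q
          · subst hyq
            have : Equiv.swap x y p = p := Equiv.swap_apply_of_ne_of_ne (Ne.symm hxp) hpq
            simp [hT, hxp, hxq, hyp, this]
          · rw [Equiv.swap_apply_of_ne_of_ne (Ne.symm hxp) (Ne.symm hyp),
              Equiv.swap_apply_of_ne_of_ne (Ne.symm hxq) (Ne.symm hyq)]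
            simp [hxp, hxq, hyp, hyq]
  have hfirst : ∀ (F : Site d n → ℝ) (r : Site d n),
      ∑ x : Site d n, ∑ e ∈ nbrs d n, (if x = r then F (x + e) else 0)
        = ∑ e ∈ nbrs d n, F (r + e) := by
    intro F r
    rw [Finset.sum_comm]
    simp
  have hsecond : ∀ (F : Site d n → ℝ) (r : Site d n),
      ∑ x : Site d n, ∑ e ∈ nbrs d n, (if x + e = r then F x else 0)
        = ∑ e ∈ nbrs d n, F (r + e) := by
    intro F r
    rw [Finset.sum_comm, ← sum_neg_nbrs fun e => F (r + e)]
    simp [← eq_sub_iff_add_eq, sub_eq_add_neg]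
  have hSsum : ∑ e ∈ nbrs d n, S (p + e)
      = ∑ e ∈ nbrs d n, if p - q + e = 0 then 0 else v (p - q + e) - v (p - q) := by
    refine Finset.sum_congr rfl fun e _ => ?_
    have h : p + e - q = p - q + e := by abel
    simp only [hS, ← h, sub_eq_zero]
  have hTsum : ∑ e ∈ nbrs d n, T (q + e)
      = ∑ e ∈ nbrs d n, if p - q + e = 0 then 0 else v (p - q + e) - v (p - q) := by
    rw [← sum_neg_nbrs]
    refine Finset.sum_congr rfl fun e _ => ?_
    have h : p - (q + -e) = p - q + e := by abel
    simp only [hT, ← h, sub_eq_zero, @eq_comm _ p]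
  rw [Finset.sum_congr rfl fun x _ => Finset.sum_congr rfl fun e he => hsplit x e he]
  simp only [Finset.sum_add_distrib]
  rw [hfirst, hsecond, hfirst, hsecond, hSsum, hTsum]
  ring

/-- The Green function of two particles, shifted to be nonnegative, as a function of
the set of occupied sites; it vanishes unless there are exactly two particles. -/
noncomputable def pairGreen (κ : ℝ) (A : Finset (Site d n)) : ℝ :=
  if A.card = 2 then (∑ p ∈ A, ∑ q ∈ A.erase p, green κ (p - q)) / 2 + green κ (0 : Site d n)
  else 0

lemma pairGreen_pair (κ : ℝ) {p q : Site d n} (hpq : p ≠ q) :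
    pairGreen κ {p, q} = green κ (p - q) + green κ (0 : Site d n) := by
  have h1 : ({p, q} : Finset (Site d n)).erase p = {q} := by
    ext; simp; grind
  have h2 : ({p, q} : Finset (Site d n)).erase q = {p} := by
    ext; simp; grind
  rw [pairGreen, if_pos (Finset.card_pair hpq), Finset.sum_pair hpq, h1, h2,
    Finset.sum_singleton, Finset.sum_singleton, ← green_neg κ (q - p), neg_sub]
  ring

lemma pairGreen_of_card_ne (κ : ℝ) {A : Finset (Site d n)} (hA : A.card ≠ 2) :
    pairGreen κ A = 0 := if_neg hA

lemma green_zero_nonneg {κ : ℝ} (hκ : 0 < κ) : 0 ≤ green κ (0 : Site d n) :=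
  (abs_nonneg _).trans (abs_green_le hκ 0)

lemma pairGreen_nonneg {κ : ℝ} (hκ : 0 < κ) (A : Finset (Site d n)) : 0 ≤ pairGreen κ A := by
  by_cases hA : A.card = 2
  · obtain ⟨p, q, hpq, rfl⟩ := Finset.card_eq_two.1 hA
    rw [pairGreen_pair κ hpq]
    linarith [(abs_le.1 (abs_green_le hκ (p - q))).1]
  · rw [pairGreen_of_card_ne κ hA]

lemma pairGreen_le {κ : ℝ} (hκ : 0 < κ) (A : Finset (Site d n)) :
    pairGreen κ A ≤ 2 * green κ (0 : Site d n) := by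
  by_cases hA : A.card = 2
  · obtain ⟨p, q, hpq, rfl⟩ := Finset.card_eq_two.1 hA
    rw [pairGreen_pair κ hpq]
    linarith [(abs_le.1 (abs_green_le hκ (p - q))).2]
  · rw [pairGreen_of_card_ne κ hA]
    linarith [green_zero_nonneg (d := d) (n := n) hκ]

open Classical in
-- Away from the origin the free walk satisfies the Green equation without source. Exclusion removes
-- the jump to the origin, where the Green function is largest; by `green_gap` this loss is at least
-- `1 / (8 * d)` on neighbouring pairs, just where the hierarchy has its source. The added constant
-- `G(0)` only increases the right-hand side.
lemma pairGreen_supersolution {κ : ℝ} (hκ : 0 < κ) (hκ1 : κ ≤ 1) (hd : 1 ≤ d) (hn : 2 ≤ n)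
    {p q : Site d n} (hpq : p ≠ q) :
    (n : ℝ) ^ 2 * ((1 / 2) * ∑ x : Site d n, ∑ e ∈ nbrs d n,
      (pairGreen κ (({p, q} : Finset (Site d n)).map (Equiv.swap x (x + e)).toEmbedding)
        - pairGreen κ {p, q}))
    ≤ κ * pairGreen κ {p, q} - if Nbr p q then 1 / (8 * (d : ℝ)) else 0 := by
  have hmap : ∀ x y : Site d n,
      pairGreen κ (({p, q} : Finset (Site d n)).map (Equiv.swap x y).toEmbedding)
        - pairGreen κ {p, q}
      = green κ (Equiv.swap x y p - Equiv.swap x y q) - green κ (p - q) := by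
    intro x y
    rw [Finset.map_insert, Finset.map_singleton, pairGreen_pair κ hpq, Equiv.coe_toEmbedding,
      pairGreen_pair κ ((Equiv.swap x y).injective.ne hpq)]
    ring
  simp only [hmap]
  rw [sum_swap_pair hn (green_neg κ) hpq, pairGreen_pair κ hpq]
  have hz : p - q ≠ 0 := sub_ne_zero.2 hpq
  have heq := green_equation hκ (p - q)
  rw [if_neg hz, sub_zero] at heq
  have hsum : ∑ e ∈ nbrs d n, (if p - q + e = 0 then 0 else
        green κ (p - q + e) - green κ (p - q))
      = ∑ e ∈ nbrs d n, (green κ (p - q + e) - green κ (p - q))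
        - if Nbr p q then green κ (0 : Site d n) - green κ (p - q) else 0 := by
    have h1 : (if Nbr p q then green κ (0 : Site d n) - green κ (p - q) else 0)
        = ∑ e ∈ nbrs d n, if e = q - p then green κ (0 : Site d n) - green κ (p - q) else 0 := by
      rw [Finset.sum_ite_eq']
      simp only [nbr_iff]
    rw [h1, ← Finset.sum_sub_distrib]
    refine Finset.sum_congr rfl fun e _ => ?_
    have h2 : p - q + e = 0 ↔ e = q - p := by
      rw [add_eq_zero_iff_neg_eq, neg_sub, eq_comm]
    by_cases he : e = q - p
    · rw [if_pos (h2.2 he), if_pos he, h2.2 he, sub_self]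
    · rw [if_neg (fun h => he (h2.1 h)), if_neg he, sub_zero]
  rw [hsum]
  have h0 := mul_nonneg hκ.le (green_zero_nonneg (d := d) (n := n) hκ)
  split_ifs with hN
  · have := green_gap hκ hκ1 hd hn (neg_mem_nbrs (nbr_iff.1 hN))
    rw [neg_sub] at this
    linarith
  · linarith

end PairExchange

/-! ### Maximum principle for the hierarchy -/

section MaximumPrinciple

variable {d n : ℕ} [NeZero n]

open Classical in
lemma sum_indicator_pair {p q : Site d n} (hpq : p ≠ q) :
    ∑ x ∈ ({p, q} : Finset (Site d n)), ∑ e ∈ nbrs d n,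
      (if ({p, q} : Finset (Site d n)) = {x, x + e} then (1 : ℝ) else 0)
      = if Nbr p q then 2 else 0 := by
  have h : ∀ x y z : Site d n, x ≠ y → (({x, y} : Finset (Site d n)) = {x, z} ↔ z = y) := by
    intro x y z hxy
    constructor
    · intro h
      have : y ∈ ({x, z} : Finset (Site d n)) := h ▸ by simp
      simpa [hxy.symm, eq_comm] using this
    · rintro rfl
      rfl
  have hs : ∀ x y : Site d n, x ≠ y → ∑ e ∈ nbrs d n,
      (if ({x, y} : Finset (Site d n)) = {x, x + e} then (1 : ℝ) else 0)
      = if Nbr x y then 1 else 0 := by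
    intro x y hxy
    simp only [h _ _ _ hxy, ← eq_sub_iff_add_eq', Finset.sum_ite_eq', nbr_iff]
  rw [Finset.sum_pair hpq, hs p q hpq, Finset.pair_comm, hs q p hpq.symm]
  by_cases hN : Nbr p q
  · rw [if_pos hN, if_pos hN.symm, if_pos hN]; norm_num
  · rw [if_neg hN, if_neg fun h => hN h.symm, if_neg hN]; norm_num

lemma ne_add_of_mem_nbrs (hn : 2 ≤ n) (x : Site d n) {e : Site d n} (he : e ∈ nbrs d n) :
    x ≠ x + e := fun h => zero_notMem_nbrs hn (by rwa [← left_eq_add.1 h])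

open Classical in
/-- The reaction part of the moment equation is dominated by the damping. -/
lemma sum_drift_le {lam γ ρ M s : ℝ} (hd : 1 ≤ d) (hn : 3 ≤ n) (hρ : ρ ∈ Set.Icc (0 : ℝ) 1)
    {μ : Config d n → ℝ} (hμ : μ ∈ stdSimplex ℝ (Config d n)) (hs : |s| ≤ 1)
    (hM : ∀ B : Finset (Site d n), B.Nonempty → |corr μ ρ B| ≤ M) (A : Finset (Site d n)) :
    s * ∑ x ∈ A, (-γ * corr μ ρ A + lam / (2 * d) * ∑ e ∈ nbrs d n, interaction μ ρ A x (x + e))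
      ≤ A.card * (-γ * (s * corr μ ρ A) + 4 * |lam| * M)
        + |lam| / (2 * d) * ∑ x ∈ A, ∑ e ∈ nbrs d n, (if A = {x, x + e} then (1 : ℝ) else 0) := by
  have hd' : (0 : ℝ) < d := by exact_mod_cast hd
  have hx : ∀ x ∈ A, s * (-γ * corr μ ρ A
        + lam / (2 * d) * ∑ e ∈ nbrs d n, interaction μ ρ A x (x + e))
      ≤ (-γ * (s * corr μ ρ A) + 4 * |lam| * M)
        + |lam| / (2 * d) * ∑ e ∈ nbrs d n, (if A = {x, x + e} then (1 : ℝ) else 0) := by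
    intro x hx
    have h1 : |∑ e ∈ nbrs d n, interaction μ ρ A x (x + e)|
        ≤ 2 * d * (4 * M) + ∑ e ∈ nbrs d n, (if A = {x, x + e} then (1 : ℝ) else 0) := by
      refine (Finset.abs_sum_le_sum_abs _ _).trans ?_
      refine (Finset.sum_le_sum fun e he =>
        abs_interaction_le hμ hρ hM hx (ne_add_of_mem_nbrs (by omega) x he)).trans (le_of_eq ?_)
      rw [Finset.sum_add_distrib, Finset.sum_const, card_nbrs hn, nsmul_eq_mul]
      push_cast
      rfl
    set I := ∑ e ∈ nbrs d n, interaction μ ρ A x (x + e)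
    set J := ∑ e ∈ nbrs d n, (if A = {x, x + e} then (1 : ℝ) else 0)
    have h2 : s * (lam / (2 * d) * I) ≤ |lam| / (2 * d) * |I| := by
      refine (le_abs_self _).trans ?_
      rw [abs_mul, abs_mul, abs_div, abs_of_pos (by positivity : (0 : ℝ) < 2 * d)]
      exact mul_le_of_le_one_left (by positivity) hs
    have h3 : |lam| / (2 * d) * |I| ≤ |lam| / (2 * d) * (2 * d * (4 * M) + J) := by gcongr
    have h4 : |lam| / (2 * d) * (2 * d * (4 * M) + J) = 4 * |lam| * M + |lam| / (2 * d) * J := by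
      field_simp
    linarith
  rw [Finset.mul_sum]
  refine (Finset.sum_le_sum hx).trans (le_of_eq ?_)
  rw [Finset.sum_add_distrib, Finset.sum_const, nsmul_eq_mul, ← Finset.mul_sum]

/-- The moment equation is evaluated at a nonempty set `D` maximising `|corr μ ρ B| - c * pairGreen
κ B`. The maximum runs over sets of every size, so the coupling between different sizes is harmless
once the damping beats `4 * |lam|`. -/
lemma abs_corr_le {a b lam ρ κ : ℝ} (hd : 1 ≤ d) (hn : 3 ≤ n) (hκ : 0 < κ) (hκ1 : κ ≤ 1)
    (ha : 16 * κ ≤ a) (hb : 0 < b) (hlam : |lam| ≤ κ) (hρ : ρ ∈ Set.Icc (0 : ℝ) 1)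
    (hzero : reaction a b lam ρ = 0) {μ : Config d n → ℝ} (hμ : IsStationary a b lam μ)
    {A : Finset (Site d n)} (hA : A.Nonempty) :
    |corr μ ρ A| ≤ 32 * (κ * green κ (0 : Site d n)) := by
  classical
  set G := green κ (0 : Site d n) with hG
  have hG0 : 0 ≤ G := green_zero_nonneg hκ
  -- Chosen so that `c / (8 * d)` equals the source `|lam| / (2 * d) * 2` of a neighbouring pair,
  -- which is counted once from each end.
  set c := 8 * |lam| with hc
  have hc0 : 0 ≤ c := by positivity
  have hd' : (0 : ℝ) < d := by exact_mod_cast hd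
  obtain ⟨D, hD, hmax⟩ := Finset.exists_max_image
    (Finset.univ.filter fun B : Finset (Site d n) => B.Nonempty)
    (fun B => |corr μ ρ B| - c * pairGreen κ B) ⟨A, by simpa using hA⟩
  replace hD : D.Nonempty := by simpa using hD
  replace hmax : ∀ B : Finset (Site d n), B.Nonempty →
      |corr μ ρ B| - c * pairGreen κ B ≤ |corr μ ρ D| - c * pairGreen κ D :=
    fun B hB => hmax B (by simpa using hB)
  set m := |corr μ ρ D| - c * pairGreen κ D with hm
  have hM : ∀ B : Finset (Site d n), B.Nonempty → |corr μ ρ B| ≤ max m 0 + c * (2 * G) := by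
    intro B hB
    have h1 := hmax B hB
    have h2 := mul_le_mul_of_nonneg_left (pairGreen_le hκ B) hc0
    have h3 := le_max_left m 0
    linarith
  set M := max m 0 + c * (2 * G) with hMdef
  -- Multiplication by the sign `s` turns the equation for the correlation into an inequality for
  -- its absolute value at `D`.
  obtain ⟨s, hs, hsD⟩ : ∃ s : ℝ, |s| ≤ 1 ∧ s * corr μ ρ D = |corr μ ρ D| := by
    rcases le_total 0 (corr μ ρ D) with h | h
    · exact ⟨1, by simp, by rw [one_mul, abs_of_nonneg h]⟩
    · exact ⟨-1, by simp, by rw [abs_of_nonpos h, neg_one_mul]⟩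
  have hsB : ∀ B, s * corr μ ρ B ≤ |corr μ ρ B| := fun B => by
    refine (le_abs_self _).trans ?_
    rw [abs_mul]
    exact mul_le_of_le_one_left (abs_nonneg _) hs
  have heq := moment_equation hd hn hzero hμ D
  have hex : s * ((n : ℝ) ^ 2 * ((1 / 2) * ∑ x : Site d n, ∑ e ∈ nbrs d n,
      (corr μ ρ (D.map (Equiv.swap x (x + e)).toEmbedding) - corr μ ρ D)))
      ≤ c * ((n : ℝ) ^ 2 * ((1 / 2) * ∑ x : Site d n, ∑ e ∈ nbrs d n,
        (pairGreen κ (D.map (Equiv.swap x (x + e)).toEmbedding) - pairGreen κ D))) := by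
    simp only [Finset.mul_sum]
    refine Finset.sum_le_sum fun x _ => Finset.sum_le_sum fun e _ => ?_
    have h1 := hmax (D.map (Equiv.swap x (x + e)).toEmbedding) (by simpa using hD)
    have h2 := hsB (D.map (Equiv.swap x (x + e)).toEmbedding)
    have h3 := mul_le_mul_of_nonneg_left
      (by linarith : s * corr μ ρ (D.map (Equiv.swap x (x + e)).toEmbedding) - s * corr μ ρ D
        ≤ c * pairGreen κ (D.map (Equiv.swap x (x + e)).toEmbedding) - c * pairGreen κ D)
      (by positivity : 0 ≤ (n : ℝ) ^ 2 * (1 / 2))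
    linarith
  have hdr := sum_drift_le (lam := lam) (γ := a + b + lam * ρ) hd hn hρ hμ.1 hs hM D
  have hpair : c * ((n : ℝ) ^ 2 * ((1 / 2) * ∑ x : Site d n, ∑ e ∈ nbrs d n,
        (pairGreen κ (D.map (Equiv.swap x (x + e)).toEmbedding) - pairGreen κ D)))
      + |lam| / (2 * d) * ∑ x ∈ D, ∑ e ∈ nbrs d n, (if D = {x, x + e} then (1 : ℝ) else 0)
      ≤ κ * (c * pairGreen κ D) := by
    by_cases hcard : D.card = 2
    · obtain ⟨p, q, hpq, hDpq⟩ := Finset.card_eq_two.1 hcard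
      rw [hDpq, sum_indicator_pair hpq]
      have h1 := mul_le_mul_of_nonneg_left
        (pairGreen_supersolution hκ hκ1 hd (by omega : 2 ≤ n) hpq) hc0
      have h2 : c * (if Nbr p q then 1 / (8 * (d : ℝ)) else 0)
          = |lam| / (2 * d) * (if Nbr p q then 2 else 0) := by
        split_ifs
        · rw [hc]; field_simp
        · simp
      rw [mul_sub, h2] at h1
      linarith
    · have h1 : ∀ x, ∀ e ∈ nbrs d n, (if D = {x, x + e} then (1 : ℝ) else 0) = 0 := by
        intro x e he
        refine if_neg fun h => hcard ?_
        rw [h, Finset.card_pair (ne_add_of_mem_nbrs (by omega) x he)]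
      rw [Finset.sum_congr rfl fun x _ => Finset.sum_congr rfl fun e he => h1 x e he]
      simp [pairGreen_of_card_ne κ hcard, pairGreen_of_card_ne, hcard]
  have hcard1 : (1 : ℝ) ≤ D.card := by exact_mod_cast hD.card_pos
  have hγ : 15 * κ ≤ a + b + lam * ρ := by
    have h1 := (abs_le.1 hlam).1
    have h2 : -κ ≤ lam * ρ := by nlinarith [hρ.1, hρ.2]
    linarith
  have hM0 : 0 ≤ M := by positivity
  have hlamM : |lam| * M ≤ κ * M := by gcongr
  have hU := pairGreen_nonneg hκ D
  have hcU : 0 ≤ c * pairGreen κ D := mul_nonneg hc0 hU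
  have hbal : 0 ≤ κ * (c * pairGreen κ D)
      + D.card * (-(a + b + lam * ρ) * |corr μ ρ D| + 4 * |lam| * M) := by
    have h := congrArg (fun t => s * t) heq
    simp only [mul_add s, mul_zero] at h
    rw [hsD] at hdr
    linarith
  -- With `|corr μ ρ D| = m + c * pairGreen κ D`, the damping of the second summand absorbs the term
  -- `κ * (c * pairGreen κ D)` left by the supersolution.
  have hmle : (a + b + lam * ρ) * m ≤ 4 * (κ * M) := by
    have h1 : |corr μ ρ D| = m + c * pairGreen κ D := by rw [hm]; ring
    rw [h1] at hbal
    by_contra hcon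
    push Not at hcon
    have h2 : κ * (c * pairGreen κ D)
        ≤ D.card * ((a + b + lam * ρ) * (c * pairGreen κ D)) := by
      have h3 : κ * (c * pairGreen κ D) ≤ (a + b + lam * ρ) * (c * pairGreen κ D) := by
        apply mul_le_mul_of_nonneg_right _ hcU
        linarith
      have h4 : 0 ≤ (a + b + lam * ρ) * (c * pairGreen κ D) :=
        mul_nonneg (by linarith) hcU
      exact h3.trans (le_mul_of_one_le_left h4 hcard1)
    have h5 : (0 : ℝ) < D.card * ((a + b + lam * ρ) * m - 4 * |lam| * M) :=
      mul_pos (by linarith) (by linarith)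
    linarith
  -- If `m > 2 * c * G`, then `M < 2 * m`, and `15 * κ * m ≤ 4 * κ * M < 8 * κ * m` is absurd. Hence
  -- `M ≤ 4 * c * G = 32 * |lam| * G`.
  have hm11 : max m 0 ≤ c * (2 * G) := by
    have hcG : 0 ≤ c * (2 * G) := by positivity
    refine max_le ?_ hcG
    by_contra hcon
    push Not at hcon
    have hm0 : 0 < m := hcG.trans_lt hcon
    rw [hMdef, max_eq_left hm0.le] at hmle
    linarith [mul_le_mul_of_nonneg_right hγ hm0.le, mul_pos hκ hm0, mul_lt_mul_of_pos_left hcon hκ]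
  have h1 := hM A hA
  have h2 : |lam| * G ≤ κ * G := by gcongr
  have h3 : c * (2 * G) = 16 * (|lam| * G) := by rw [hc]; ring
  linarith

end MaximumPrinciple

/-! ### Expansion of local functions in centred products -/

section Expansion

variable {d n : ℕ}

/-- Every function of the configuration in `S` is a combination of products of centred occupation
numbers. -/
lemma exists_expansion {ρ : ℝ} (hρ : ρ ∈ Set.Icc (0 : ℝ) 1) (S : Finset (Site d n)) :
    ∀ (F : Config d n → ℝ) (B : ℝ), (∀ η ζ : Config d n, (∀ x ∈ S, η x = ζ x) → F η = F ζ) →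
      (∀ η, |F η| ≤ B) →
      ∃ c : Finset (Site d n) → ℝ, (∀ η, F η = ∑ A ∈ S.powerset, c A * centred ρ A η) ∧
        ∑ A ∈ S.powerset, |c A| ≤ 3 ^ S.card * B := by
  induction S using Finset.induction_on with
  | empty =>
    intro F B hF hB
    refine ⟨fun _ => F fun _ => false, fun η => ?_, ?_⟩
    · simpa [centred_empty] using hF η _ (by simp)
    · simpa using hB _
  | insert x S hx ih =>
    intro F B hF hB
    set F0 : Config d n → ℝ := fun η => F (Function.update η x false) with hF0
    set F1 : Config d n → ℝ := fun η => F (Function.update η x true) with hF1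
    have hdep : ∀ (v : Bool) (η ζ : Config d n), (∀ y ∈ S, η y = ζ y) →
        F (Function.update η x v) = F (Function.update ζ x v) := by
      intro v η ζ h
      refine hF _ _ fun y hy => ?_
      by_cases hyx : y = x
      · subst hyx; simp
      · simpa [hyx] using h y (Finset.mem_of_mem_insert_of_ne hy hyx)
    -- `F` is its average over the value at `x` plus `occ η x - ρ` times its discrete derivative.
    -- These are bounded by `B` and `2 * B`, hence a factor 3 per site, uniformly in `ρ`.
    obtain ⟨c0, hc0, hc0'⟩ := ih (fun η => (1 - ρ) * F0 η + ρ * F1 η) B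
      (fun η ζ h => by simp only [hF0, hF1, hdep _ η ζ h])
      (fun η => by
        have h0 := abs_le.1 (hB (Function.update η x false))
        have h1 := abs_le.1 (hB (Function.update η x true))
        obtain ⟨hr0, hr1⟩ := hρ
        rw [abs_le]
        constructor <;> simp only [hF0, hF1] <;> nlinarith)
    obtain ⟨c1, hc1, hc1'⟩ := ih (fun η => F1 η - F0 η) (2 * B)
      (fun η ζ h => by simp only [hF0, hF1, hdep _ η ζ h])
      (fun η => by
        have h0 := abs_le.1 (hB (Function.update η x false))
        have h1 := abs_le.1 (hB (Function.update η x true))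
        rw [abs_le]
        constructor <;> simp only [hF0, hF1] <;> linarith)
    have hxA : ∀ A ∈ S.powerset, x ∉ A := fun A hA h => hx (Finset.mem_powerset.1 hA h)
    refine ⟨fun A => if x ∈ A then c1 (A.erase x) else c0 A, fun η => ?_, ?_⟩
    · have hsplit : F η = ((1 - ρ) * F0 η + ρ * F1 η) + (occ η x - ρ) * (F1 η - F0 η) := by
        cases hv : η x
        · have : F0 η = F η := by simp only [hF0]; rw [← hv, Function.update_eq_self]
          rw [← this]
          simp only [occ, hv, Bool.false_eq_true, if_false]
          ring
        · have : F1 η = F η := by simp only [hF1]; rw [← hv, Function.update_eq_self]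
          rw [← this]
          simp only [occ, hv, if_true]
          ring
      rw [hsplit, hc0, hc1, Finset.sum_powerset_insert hx, Finset.mul_sum]
      congr 1
      · exact Finset.sum_congr rfl fun A hA => by beta_reduce; rw [if_neg (hxA A hA)]
      · refine Finset.sum_congr rfl fun A hA => ?_
        beta_reduce
        rw [if_pos (Finset.mem_insert_self _ _), Finset.erase_insert (hxA A hA),
          centred_insert ρ (hxA A hA)]
        ring
    · rw [Finset.sum_powerset_insert hx, Finset.card_insert_of_notMem hx, pow_succ]
      have h0 : ∑ A ∈ S.powerset, |if x ∈ A then c1 (A.erase x) else c0 A|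
          = ∑ A ∈ S.powerset, |c0 A| :=
        Finset.sum_congr rfl fun A hA => by rw [if_neg (hxA A hA)]
      have h1 : ∑ A ∈ S.powerset, |if x ∈ insert x A then c1 ((insert x A).erase x)
          else c0 (insert x A)| = ∑ A ∈ S.powerset, |c1 A| :=
        Finset.sum_congr rfl fun A hA => by
          rw [if_pos (Finset.mem_insert_self _ _), Finset.erase_insert (hxA A hA)]
      rw [h0, h1]
      linarith

lemma centred_shift (ρ : ℝ) (A : Finset (Site d n)) (x : Site d n) (η : Config d n) :
    centred ρ A (shift x η) = centred ρ (A.map (Equiv.addRight x).toEmbedding) η := by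
  rw [centred, centred, Finset.prod_map]
  rfl

variable [NeZero n]

lemma expect_bernoulli_centred (ρ : ℝ) (A : Finset (Site d n)) :
    expect (bernoulli ρ) (centred ρ A) = if A = ∅ then 1 else 0 := by
  let w : Site d n → Bool → ℝ := fun x v =>
    ((if v then 1 else 0) * ρ + (1 - if v then 1 else 0) * (1 - ρ))
      * (if x ∈ A then (if v then (1 : ℝ) else 0) - ρ else 1)
  have h : expect (bernoulli ρ) (centred ρ A) = ∏ x, ∑ v, w x v := by
    rw [Finset.prod_univ_sum, Fintype.piFinset_univ, expect]
    refine Finset.sum_congr rfl fun η _ => ?_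
    rw [Finset.prod_mul_distrib, bernoulli, centred]
    congr 1
    rw [Finset.prod_ite_mem, Finset.univ_inter]
    rfl
  rw [h]
  split_ifs with hA
  · simp [w, hA]
  · obtain ⟨x, hx⟩ := Finset.nonempty_iff_ne_empty.2 hA
    refine Finset.prod_eq_zero (Finset.mem_univ x) ?_
    simp [w, hx]
    ring

lemma expect_bernoulli_expansion {ρ : ℝ} {S : Finset (Site d n)} {F : Config d n → ℝ}
    {c : Finset (Site d n) → ℝ} (hF : ∀ η, F η = ∑ A ∈ S.powerset, c A * centred ρ A η) :
    expect (bernoulli ρ) F = c ∅ := by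
  rw [funext hF, expect_sum]
  simp only [expect_const_mul, expect_bernoulli_centred]
  simp

end Expansion

/-! ### Second moment of the field -/

section SecondMoment

variable {d n : ℕ} [NeZero n]

/-- The translate by `x` of the centred local function with coefficients `c`. -/
noncomputable def translate (ρ : ℝ) (S : Finset (Site d n)) (c : Finset (Site d n) → ℝ)
    (x : Site d n) (η : Config d n) : ℝ :=
  ∑ A ∈ S.powerset.erase ∅, c A * centred ρ (A.map (Equiv.addRight x).toEmbedding) η

/-- The coefficient of the empty set is the Bernoulli mean, so centring leaves nonempty sets only,
to which the correlation bound applies. -/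
lemma sub_expect_bernoulli {ρ : ℝ} {S : Finset (Site d n)} {F : Config d n → ℝ}
    {c : Finset (Site d n) → ℝ} (hF : ∀ η, F η = ∑ A ∈ S.powerset, c A * centred ρ A η)
    (x : Site d n) (η : Config d n) :
    F (shift x η) - expect (bernoulli ρ) F = translate ρ S c x η := by
  rw [expect_bernoulli_expansion hF, hF, translate,
    ← Finset.add_sum_erase _ _ (Finset.empty_mem_powerset S), centred_empty, mul_one,
    add_sub_cancel_left]
  simp only [centred_shift]

omit [NeZero n] in
lemma sum_erase_abs_le {S : Finset (Site d n)} {c : Finset (Site d n) → ℝ} {K : ℝ}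
    (hc : ∑ A ∈ S.powerset, |c A| ≤ K) : ∑ A ∈ S.powerset.erase ∅, |c A| ≤ K :=
  (Finset.sum_le_sum_of_subset_of_nonneg (Finset.erase_subset _ _)
    fun _ _ _ => abs_nonneg _).trans hc

omit [NeZero n] in
lemma abs_translate_le {ρ : ℝ} (hρ : ρ ∈ Set.Icc (0 : ℝ) 1) {S : Finset (Site d n)}
    {c : Finset (Site d n) → ℝ} {K : ℝ} (hc : ∑ A ∈ S.powerset, |c A| ≤ K) (x : Site d n)
    (η : Config d n) : |translate ρ S c x η| ≤ K := by
  refine (Finset.abs_sum_le_sum_abs _ _).trans (le_trans ?_ (sum_erase_abs_le hc))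
  refine Finset.sum_le_sum fun A _ => ?_
  rw [abs_mul]
  exact mul_le_of_le_one_right (abs_nonneg _) (abs_centred_le hρ _ η)

lemma abs_expect_translate_mul_le_sq {ρ : ℝ} (hρ : ρ ∈ Set.Icc (0 : ℝ) 1)
    {μ : Config d n → ℝ} (hμ : μ ∈ stdSimplex ℝ (Config d n)) {S : Finset (Site d n)}
    {c : Finset (Site d n) → ℝ} {K : ℝ} (hc : ∑ A ∈ S.powerset, |c A| ≤ K) (x y : Site d n) :
    |expect μ fun η => translate ρ S c x η * translate ρ S c y η| ≤ K ^ 2 := by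
  refine abs_expect_le hμ fun η => ?_
  rw [abs_mul, sq]
  have hx := abs_translate_le hρ hc x η
  exact mul_le_mul hx (abs_translate_le hρ hc y η) (abs_nonneg _) ((abs_nonneg _).trans hx)

/-- The differences of the elements of `S`. -/
def differences (S : Finset (Site d n)) : Finset (Site d n) :=
  (S ×ˢ S).image fun p => p.1 - p.2

omit [NeZero n] in
lemma card_differences_le (S : Finset (Site d n)) : (differences S).card ≤ S.card ^ 2 := by
  refine Finset.card_image_le.trans ?_
  rw [Finset.card_product, sq]

/-- The translated supports are disjoint, so a product of two centred products is again a centred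
product, over a nonempty union. -/
lemma abs_expect_translate_mul_le {ρ M : ℝ} {μ : Config d n → ℝ}
    (hM : ∀ B : Finset (Site d n), B.Nonempty → |corr μ ρ B| ≤ M) {S : Finset (Site d n)}
    {c : Finset (Site d n) → ℝ} {K : ℝ} (hc : ∑ A ∈ S.powerset, |c A| ≤ K) (hM0 : 0 ≤ M)
    {x y : Site d n} (hxy : y - x ∉ differences S) :
    |expect μ fun η => translate ρ S c x η * translate ρ S c y η| ≤ K ^ 2 * M := by
  have hdisj : ∀ A ∈ S.powerset.erase ∅, ∀ B ∈ S.powerset.erase ∅,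
      Disjoint (A.map (Equiv.addRight x).toEmbedding) (B.map (Equiv.addRight y).toEmbedding) := by
    intro A hA B hB
    rw [Finset.disjoint_left]
    intro z hzA hzB
    obtain ⟨s, hs, rfl⟩ := Finset.mem_map.1 hzA
    obtain ⟨t, ht, hst⟩ := Finset.mem_map.1 hzB
    refine hxy (Finset.mem_image.2 ⟨(s, t), Finset.mem_product.2
      ⟨Finset.mem_powerset.1 (Finset.mem_of_mem_erase hA) hs,
        Finset.mem_powerset.1 (Finset.mem_of_mem_erase hB) ht⟩, ?_⟩)
    replace hst : t + y = s + x := hst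
    change s - t = y - x
    rw [sub_eq_sub_iff_add_eq_add, ← hst, add_comm]
  have hexp : (expect μ fun η => translate ρ S c x η * translate ρ S c y η)
      = ∑ A ∈ S.powerset.erase ∅, ∑ B ∈ S.powerset.erase ∅, c A * c B *
        corr μ ρ (A.map (Equiv.addRight x).toEmbedding ∪ B.map (Equiv.addRight y).toEmbedding) := by
    simp only [translate, Finset.sum_mul_sum, expect_sum]
    refine Finset.sum_congr rfl fun A hA => Finset.sum_congr rfl fun B hB => ?_
    rw [corr, ← expect_const_mul]
    congr 1
    ext η
    rw [centred_union ρ (hdisj A hA B hB)]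
    ring
  rw [hexp]
  have hK := sum_erase_abs_le hc
  have hK0 : 0 ≤ ∑ A ∈ S.powerset.erase ∅, |c A| := Finset.sum_nonneg fun _ _ => abs_nonneg _
  calc _ ≤ ∑ A ∈ S.powerset.erase ∅, ∑ B ∈ S.powerset.erase ∅, |c A| * |c B| * M := by
        refine (Finset.abs_sum_le_sum_abs _ _).trans (Finset.sum_le_sum fun A hA => ?_)
        refine (Finset.abs_sum_le_sum_abs _ _).trans (Finset.sum_le_sum fun B _ => ?_)
        rw [abs_mul, abs_mul]
        refine mul_le_mul_of_nonneg_left (hM _ ?_) (by positivity)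
        refine Finset.Nonempty.inl (Finset.Nonempty.map ?_)
        exact Finset.nonempty_iff_ne_empty.2 (Finset.ne_of_mem_erase hA)
    _ = (∑ A ∈ S.powerset.erase ∅, |c A|) ^ 2 * M := by
        rw [sq, Finset.sum_mul_sum, Finset.sum_mul]
        exact Finset.sum_congr rfl fun A _ => by rw [Finset.sum_mul]
    _ ≤ K ^ 2 * M := by gcongr

/-- Cauchy–Schwarz for the uniform part of the kernel. For the part near the diagonal, `2 |u x| |u
y| ≤ u x ^ 2 + u y ^ 2` for each displacement in `V`. -/
lemma sum_sum_mul_ite_le (V : Finset (Site d n)) (u : Site d n → ℝ) {δ k : ℝ} (hδ : 0 ≤ δ)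
    (hk : 0 ≤ k) :
    ∑ x, ∑ y, |u x| * |u y| * (δ + if y - x ∈ V then k else 0)
      ≤ ((n : ℝ) ^ d * δ + V.card * k) * ∑ x, u x ^ 2 := by
  have h1 : ∑ x, ∑ y, |u x| * |u y| * δ ≤ (n : ℝ) ^ d * δ * ∑ x, u x ^ 2 := by
    have := sq_sum_le_card_mul_sum_sq (s := Finset.univ) (f := fun x => |u x|)
    have hcard : (((Finset.univ : Finset (Site d n)).card : ℕ) : ℝ) = (n : ℝ) ^ d := by
      simp [ZMod.card]
    simp only [sq_abs, hcard] at this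
    have h2 : ∑ x, ∑ y, |u x| * |u y| * δ = δ * (∑ x, |u x|) ^ 2 := by
      rw [sq, Finset.sum_mul_sum, Finset.mul_sum]
      refine Finset.sum_congr rfl fun x _ => ?_
      rw [Finset.mul_sum]
      exact Finset.sum_congr rfl fun y _ => by ring
    rw [h2]
    nlinarith
  have h2 : ∑ x, ∑ y, |u x| * |u y| * (if y - x ∈ V then k else 0)
      ≤ V.card * k * ∑ x, u x ^ 2 := by
    have h3 : ∀ x, ∑ y, |u x| * |u y| * (if y - x ∈ V then k else 0)
        = ∑ v ∈ V, |u x| * |u (x + v)| * k := by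
      intro x
      rw [← Fintype.sum_equiv (Equiv.addLeft x)
        (fun v => |u x| * |u (x + v)| * if v ∈ V then k else 0) _ (fun v => by simp)]
      simp only [mul_ite, mul_zero]
      rw [Finset.sum_ite_mem, Finset.univ_inter]
    rw [Finset.sum_congr rfl fun x _ => h3 x, Finset.sum_comm, mul_assoc, ← nsmul_eq_mul]
    refine Finset.sum_le_card_nsmul _ _ _ fun v _ => ?_
    have h4 : ∑ x, u (x + v) ^ 2 = ∑ x, u x ^ 2 :=
      Fintype.sum_equiv (Equiv.addRight v) _ _ fun x => rfl
    calc ∑ x, |u x| * |u (x + v)| * k ≤ ∑ x, (k / 2) * (u x ^ 2 + u (x + v) ^ 2) := by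
          refine Finset.sum_le_sum fun x _ => ?_
          rw [← sq_abs (u x), ← sq_abs (u (x + v))]
          nlinarith [mul_nonneg hk (sq_nonneg (|u x| - |u (x + v)|))]
      _ = k * ∑ x, u x ^ 2 := by
          rw [← Finset.mul_sum, Finset.sum_add_distrib, h4]
          ring
  have h3 : ∑ x, ∑ y, |u x| * |u y| * (δ + if y - x ∈ V then k else 0)
      = ∑ x, ∑ y, |u x| * |u y| * δ
        + ∑ x, ∑ y, |u x| * |u y| * (if y - x ∈ V then k else 0) := by
    rw [← Finset.sum_add_distrib]
    refine Finset.sum_congr rfl fun x _ => ?_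
    rw [← Finset.sum_add_distrib]
    exact Finset.sum_congr rfl fun y _ => by ring
  rw [h3, add_mul]
  exact add_le_add h1 h2

lemma expect_sq_le {μ : Config d n → ℝ} (X : Site d n → Config d n → ℝ) (V : Finset (Site d n))
    (u : Site d n → ℝ) {δ k : ℝ} (hδ : 0 ≤ δ) (hk : 0 ≤ k)
    (hX : ∀ x y, |expect μ fun η => X x η * X y η| ≤ δ + if y - x ∈ V then k else 0) :
    expect μ (fun η => (1 / (n : ℝ) ^ d * ∑ x, X x η * u x) ^ 2)
      ≤ (δ + V.card * k * ((n : ℝ) ^ d)⁻¹) * (1 / (n : ℝ) ^ d * ∑ x, u x ^ 2) := by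
  have hn : (0 : ℝ) < n := by exact_mod_cast NeZero.pos n
  have h1 : (fun η => (1 / (n : ℝ) ^ d * ∑ x, X x η * u x) ^ 2)
      = fun η => (1 / (n : ℝ) ^ d) ^ 2 * ∑ x, ∑ y, (u x * u y) * (X x η * X y η) := by
    ext η
    rw [mul_pow, sq (∑ x, X x η * u x), Finset.sum_mul_sum]
    congr 1
    exact Finset.sum_congr rfl fun x _ => Finset.sum_congr rfl fun y _ => by ring
  rw [h1, expect_const_mul, expect_sum]
  have h2 : ∑ x, expect μ (fun η => ∑ y, (u x * u y) * (X x η * X y η))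
      ≤ ((n : ℝ) ^ d * δ + V.card * k) * ∑ x, u x ^ 2 := by
    refine le_trans ?_ (sum_sum_mul_ite_le V u hδ hk)
    refine Finset.sum_le_sum fun x _ => ?_
    rw [expect_sum]
    refine Finset.sum_le_sum fun y _ => ?_
    rw [expect_const_mul]
    refine (le_abs_self _).trans ?_
    rw [abs_mul, abs_mul]
    exact mul_le_mul_of_nonneg_left (hX x y) (by positivity)
  refine (mul_le_mul_of_nonneg_left h2 (by positivity)).trans (le_of_eq ?_)
  field_simp

end SecondMoment

/-! ### Local functions on the lattice and on the torus -/

section LocalFunctions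

variable {d : ℕ}

/-- The cube of the sites of `ℤ^d` with sup norm at most `R`. -/
noncomputable def cube (d R : ℕ) : Finset (Fin d → ℤ) :=
  Fintype.piFinset fun _ => Finset.Icc (-(R : ℤ)) R

lemma mem_cube {R : ℕ} {z : Fin d → ℤ} : z ∈ cube d R ↔ ∀ i, |z i| ≤ (R : ℤ) := by
  simp [cube, abs_le]

lemma card_cube (R : ℕ) : (cube d R).card = (2 * R + 1) ^ d := by
  rw [cube, Fintype.card_piFinset_const, Int.card_Icc]
  congr 1
  omega

lemma HasSupportIn.exists_bound {R : ℕ} {ψ : ((Fin d → ℤ) → Bool) → ℝ}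
    (hψ : HasSupportIn R ψ) : ∃ B : ℝ, ∀ η, |ψ η| ≤ B := by
  classical
  let ext : (cube d R → Bool) → (Fin d → ℤ) → Bool :=
    fun c z => if h : z ∈ cube d R then c ⟨z, h⟩ else false
  refine ⟨∑ c, |ψ (ext c)|, fun η => ?_⟩
  have h : ψ η = ψ (ext fun z => η z) := hψ _ _ fun z hz => by
    simp [ext, mem_cube.2 hz]
  rw [h]
  exact Finset.single_le_sum (f := fun c => |ψ (ext c)|) (fun _ _ => abs_nonneg _)
    (Finset.mem_univ fun z : cube d R => η z)

/-- The image of the cube in the discrete torus. -/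
noncomputable def torusCube (d R n : ℕ) : Finset (Site d n) :=
  (cube d R).image fun z i => (z i : ZMod n)

lemma card_torusCube_le (R n : ℕ) : (torusCube d R n).card ≤ (2 * R + 1) ^ d :=
  Finset.card_image_le.trans (card_cube R).le

lemma HasSupportIn.onTorus_congr {R n : ℕ} {ψ : ((Fin d → ℤ) → Bool) → ℝ}
    (hψ : HasSupportIn R ψ) (η ζ : Config d n) (h : ∀ x ∈ torusCube d R n, η x = ζ x) :
    onTorus n ψ η = onTorus n ψ ζ :=
  hψ _ _ fun _ hz => h _ (Finset.mem_image_of_mem _ (mem_cube.2 hz))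

end LocalFunctions

end ReactionDiffusion

/-! ### The main theorem -/

open ReactionDiffusion in
theorem theorem3p2 (d : ℕ) (hd : 1 ≤ d) :
    ∃ lamc : ℝ → ℝ → ℝ,
      (∀ a b : ℝ, 0 < a → 0 < b → 0 < lamc a b ∧ lamc a b < a) ∧
      ∀ (R : ℕ) (ψ : ((Fin d → ℤ) → Bool) → ℝ), ReactionDiffusion.HasSupportIn R ψ →
        ∃ C : ℝ → ℝ, ContinuousOn C (Set.Ioo 0 1) ∧
          ∀ a b lam : ℝ, 0 < a → 0 < b → lam ∈ Set.Icc (-lamc a b) (lamc a b) →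
          ∀ ρ ∈ Set.Icc (0 : ℝ) 1, ReactionDiffusion.reaction a b lam ρ = 0 →
          ∀ (n : ℕ) [NeZero n], 2 ≤ n →
          ∀ μ : ReactionDiffusion.Config d n → ℝ, ReactionDiffusion.IsStationary a b lam μ →
          ∀ f : C(UnitAddTorus (Fin d), ℝ),
            ReactionDiffusion.expect μ (fun η => ReactionDiffusion.field ψ ρ f η ^ 2) ≤
              C ρ * ReactionDiffusion.normSq n f * ReactionDiffusion.g d n / (n : ℝ) ^ 2 := by
  -- The threshold also serves as the killing rate `κ`: the bound `a / 16` makes the damping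
  -- dominate the coupling, and `κ ≤ 1` is needed for `green_gap`.
  refine ⟨fun a _ => min a 1 / 16, fun a b ha _ => ?_, fun R ψ hψ => ?_⟩
  · have h1 : 0 < min a 1 := lt_min ha one_pos
    have h2 := min_le_left a 1
    constructor <;> linarith
  obtain ⟨B, hB⟩ := hψ.exists_bound
  have hB0 : 0 ≤ B := (abs_nonneg _).trans (hB fun _ => false)
  set s : ℕ := (2 * R + 1) ^ d
  set K : ℝ := 3 ^ s * B with hK
  have hK0 : 0 ≤ K := by positivity
  -- The expansion coefficients are bounded uniformly in `ρ`, so a constant function of `ρ`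
  -- suffices. The two summands come from disjoint and from overlapping translates.
  refine ⟨fun _ => K ^ 2 * (32 * (3 + 3 ^ d) + 2 * (s : ℝ) ^ 2), continuousOn_const, ?_⟩
  intro a b lam ha hb hlam ρ hρ hzero n _ hn μ hμ f
  set κ : ℝ := min a 1 / 16 with hκdef
  have hκ : 0 < κ := by have := lt_min ha one_pos; positivity
  have hκ1 : κ ≤ 1 := by have := min_le_right a 1; linarith
  have hκa : 16 * κ ≤ a := by have := min_le_left a 1; linarith
  obtain ⟨c, hc, hcK⟩ := exists_expansion hρ (torusCube d R n) (onTorus n ψ) B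
    hψ.onTorus_congr (fun η => hB _)
  set S := torusCube d R n
  have hS : S.card ≤ s := card_torusCube_le R n
  replace hcK : ∑ A ∈ S.powerset, |c A| ≤ K := by
    refine hcK.trans ?_
    rw [hK]
    gcongr
    norm_num
  have hfield : (fun η : Config d n => field ψ ρ f η ^ 2)
      = fun η => (1 / (n : ℝ) ^ d * ∑ x, translate ρ S c x η * f (toTorus x)) ^ 2 := by
    ext η
    rw [field]
    simp only [sub_expect_bernoulli hc]
  have hnorm : 0 ≤ normSq n f :=
    mul_nonneg (by positivity) (Finset.sum_nonneg fun _ _ => sq_nonneg _)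
  have hn0 : (0 : ℝ) < n := by exact_mod_cast NeZero.pos n
  have hg := g_pos (d := d) hn
  have hg0 : 0 ≤ g d n / (n : ℝ) ^ 2 := by positivity
  have hbound : ∃ δ k : ℝ, 0 ≤ δ ∧ 0 ≤ k ∧ k ≤ K ^ 2 ∧
      δ ≤ K ^ 2 * (32 * (3 + 3 ^ d) * (g d n / (n : ℝ) ^ 2)) ∧
      ∀ x y, |expect μ fun η => translate ρ S c x η * translate ρ S c y η|
        ≤ δ + if y - x ∈ differences S then k else 0 := by
    -- For `n = 2` the moment equation in the form used is not available, but `g d n / n ^ 2` is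
    -- then at least `1 / 8`, and the trivial bound `K ^ 2` suffices.
    rcases Nat.lt_or_ge n 3 with h3 | h3
    · refine ⟨K ^ 2, 0, by positivity, le_rfl, by positivity, ?_, fun x y => ?_⟩
      · obtain rfl : n = 2 := by omega
        have h1 := one_le_two_mul_g (d := d) hn
        have h2 : (0 : ℝ) ≤ 3 ^ d := by positivity
        refine le_mul_of_one_le_right (by positivity) ?_
        push_cast
        nlinarith
      · simpa using abs_expect_translate_mul_le_sq hρ hμ.1 hcK x y
    · have hM := fun (A : Finset (Site d n)) (hA : A.Nonempty) =>
        (abs_corr_le hd h3 hκ hκ1 hκa hb (abs_le.2 hlam) hρ hzero hμ hA).trans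
          (mul_le_mul_of_nonneg_left (mul_green_zero_le_g hκ hκ1 hd hn) (by norm_num))
      have hM0 : 0 ≤ 32 * ((3 + 3 ^ d) * (g d n / (n : ℝ) ^ 2)) := by positivity
      refine ⟨K ^ 2 * (32 * ((3 + 3 ^ d) * (g d n / (n : ℝ) ^ 2))), K ^ 2, by positivity,
        by positivity, le_rfl, by rw [mul_assoc 32], fun x y => ?_⟩
      split_ifs with h
      · have := abs_expect_translate_mul_le_sq hρ hμ.1 hcK x y
        have h0 := mul_nonneg (sq_nonneg K) hM0
        linarith
      · rw [add_zero]
        exact abs_expect_translate_mul_le hM hcK hM0 h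
  obtain ⟨δ, k, hδ0, hk0, hk, hδ, hX⟩ := hbound
  rw [hfield]
  refine (expect_sq_le _ (differences S) _ hδ0 hk0 hX).trans ?_
  have hV : ((differences S).card : ℝ) ≤ (s : ℝ) ^ 2 := by
    exact_mod_cast (card_differences_le S).trans (Nat.pow_le_pow_left hS 2)
  have h1 : (differences S).card * k * ((n : ℝ) ^ d)⁻¹
      ≤ (s : ℝ) ^ 2 * K ^ 2 * (2 * (g d n / (n : ℝ) ^ 2)) := by
    gcongr
    exact inv_pow_le_g hd hn
  have h2 : δ + (differences S).card * k * ((n : ℝ) ^ d)⁻¹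
      ≤ K ^ 2 * (32 * (3 + 3 ^ d) + 2 * (s : ℝ) ^ 2) * (g d n / (n : ℝ) ^ 2) := by linarith
  refine (mul_le_mul_of_nonneg_right h2 hnorm).trans (le_of_eq ?_)
  ring
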